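/- Let $\mathfrak A=(a(n))_{n\ge 1}$ be a sequence of complex numbers such that (i) for some constant $\kappa\ge 1$ and every $\varepsilon>0$, $a(n)\ll_\varepsilon n^{(\kappa-1)/2+\varepsilon}$; (ii) the Dirichlet series $L(s;\mathfrak A)=\sum_{n\ge1}a(n)n^{-s}$ (absolutely convergent for $\Re s>(\kappa+1)/2$) continues to a meromorphic function on $\mathbb C$ with only finitely many poles. Put $A_c(l)=\sum_{0<n\mid l}n^c a(n)$, let $$\Psi(a,b;x)=\frac1{\Gamma(a)}\int_0^{e^{i\phi}\infty}e^{-xy}y^{a-1}(y+1)^{b-a-1}\,dy\qquad(\Re a>0,\ -\pi<\phi<\pi,\ |\phi+\arg x|<\pi/2)$$ be the confluent hypergeometric function, and let $$F_\pm(s_1,s_2;\mathfrak A)=\sum_{l\ge1}A_{s_1+s_2-1}(l)\,\Psi(s_2,s_1+s_2;\pm2\pi i l),\qquad L_2(s_1,s_2;\mathfrak A)=\sum_{m,n\ge1}\frac{a(n)}{m^{s_1}(m+n)^{s_2}},$$ $$L_1(s_1,s_2;\mathfrak A)=\frac{\Gamma(1-s_1)\Gamma(s_1+s_2-1)}{\Gamma(s_2)}L(s_1+s_2-1;\mathfrak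 A).$$ Then the series $F_\pm(s_1,s_2;\mathfrak A)$ converge absolutely for $\Re s_1<(1-\kappa)/2$, $\Re s_2>1$ and continue meromorphically to $\mathbb C^2$; the double series $L_2(s_1,s_2;\mathfrak A)$ converges absolutely for $\Re s_2>(\kappa+1)/2$, $\Re(s_1+s_2)>(\kappa+3)/2$ and continues meromorphically to $\mathbb C^2$; and for all $(s_1,s_2)\in\mathbb C^2$ away from the singularities of the functions involved, $$L_2(s_1,s_2;\mathfrak A)=L_1(s_1,s_2;\mathfrak A)+\Gamma(1-s_1)\bigl\{F_+(1-s_2,1-s_1;\mathfrak A)+F_-(1-s_2,1-s_1;\mathfrak A)\bigr\}.$$ -/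

import Mathlib

open Filter Topology Asymptotics

noncomputable section

/-! ### Meromorphic functions of two complex variables -/

/-- `F` and `G` agree near `p` outside the zero set of a holomorphic germ at `p` that does not
vanish identically. -/
def GenericEqAt (F G : ℂ × ℂ → ℂ) (p : ℂ × ℂ) : Prop :=
  ∃ h : ℂ × ℂ → ℂ, AnalyticAt ℂ h p ∧ ¬ (∀ᶠ z in 𝓝 p, h z = 0) ∧
    ∀ᶠ z in 𝓝 p, h z ≠ 0 → F z = G z

/-- Near `p`, `F` is a quotient of two holomorphic functions, the denominator not being
identically zero. Values of `F` on a zero set as in `GenericEqAt` do not matter. -/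
def MeromorphicAtTwo (F : ℂ × ℂ → ℂ) (p : ℂ × ℂ) : Prop :=
  ∃ g k : ℂ × ℂ → ℂ, AnalyticAt ℂ g p ∧ AnalyticAt ℂ k p ∧ ¬ (∀ᶠ z in 𝓝 p, k z = 0) ∧
    GenericEqAt F (fun z => g z / k z) p

/-- The meromorphic function represented by `F` has no singularity at `p` (or only a removable
one). -/
def RegularAtTwo (F : ℂ × ℂ → ℂ) (p : ℂ × ℂ) : Prop :=
  ∃ g : ℂ × ℂ → ℂ, AnalyticAt ℂ g p ∧ GenericEqAt F g p

/-- `F` is a meromorphic function on `ℂ²` which takes the correct value at each of its regular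
points: all removable singularities have been removed. The points where such an `F` is not
analytic are exactly the singularities (poles and points of indeterminacy) of the meromorphic
function. -/
def IsMeromorphicTwo (F : ℂ × ℂ → ℂ) : Prop :=
  ∀ p, MeromorphicAtTwo F p ∧ (RegularAtTwo F p → AnalyticAt ℂ F p)

/-! ### The confluent hypergeometric function and the series -/

/-- `Γ(a)⁻¹ ∫ e^{-xy} y^{a-1} (y+1)^{b-a-1} dy` over the ray `y = r e^{iφ}`, `0 < r < ∞`. -/
def confluentPsiRay (φ : ℝ) (a b x : ℂ) : ℂ :=
  (Complex.Gamma a)⁻¹ * ∫ r in Set.Ioi (0 : ℝ),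
    Complex.exp (-x * (r * Complex.exp (φ * Complex.I)))
      * (r * Complex.exp (φ * Complex.I)) ^ (a - 1)
      * (r * Complex.exp (φ * Complex.I) + 1) ^ (b - a - 1)
      * Complex.exp (φ * Complex.I)

/-- The confluent hypergeometric function `Ψ(a,b;x)`, for `Re a > 0` and `x` off the
non-positive real axis. Any ray with `-π < φ < π` and `|φ + arg x| < π/2` gives the same value;
here `φ = -arg x`, on which `xy` is positive. -/
def confluentPsi (a b x : ℂ) : ℂ :=
  confluentPsiRay (-Complex.arg x) a b x

/-- `A_c(l) = ∑_{n ∣ l} n^c a(n)`. -/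
def twistedDivisorSum (a : ℕ → ℂ) (c : ℂ) (l : ℕ) : ℂ :=
  ∑ n ∈ l.divisors, (n : ℂ) ^ c * a n

/-- The `l`-th term of `F_±(s₁,s₂)`, where `e = ±1` is the sign. -/
def termF (e : ℤˣ) (a : ℕ → ℂ) (s₁ s₂ : ℂ) (l : ℕ+) : ℂ :=
  twistedDivisorSum a (s₁ + s₂ - 1) l
    * confluentPsi s₂ (s₁ + s₂) (((e : ℤ) : ℂ) * (2 * Real.pi * Complex.I * (l : ℕ)))

/-- The term of index `(m,n)` of the double series `L₂(s₁,s₂)`. -/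
def termL₂ (a : ℕ → ℂ) (s₁ s₂ : ℂ) (mn : ℕ+ × ℕ+) : ℂ :=
  a mn.2 / (((mn.1 : ℕ) : ℂ) ^ s₁ * (((mn.1 : ℕ) : ℂ) + ((mn.2 : ℕ) : ℂ)) ^ s₂)

/-- `F` is the meromorphic continuation to `ℂ²` of the series `F_±(s₁,s₂)`, which converges
absolutely for `Re s₁ < (1-κ)/2`, `Re s₂ > 1`. -/
def IsContinuationF (e : ℤˣ) (κ : ℝ) (a : ℕ → ℂ) (F : ℂ × ℂ → ℂ) : Prop :=
  IsMeromorphicTwo F ∧ ∀ s₁ s₂ : ℂ, s₁.re < (1 - κ) / 2 → 1 < s₂.re →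
    HasSum (termF e a s₁ s₂) (F (s₁, s₂))

/-- `L₂` is the meromorphic continuation to `ℂ²` of the double series, which converges absolutely
for `Re s₂ > (κ+1)/2`, `Re (s₁+s₂) > (κ+3)/2`. -/
def IsContinuationL₂ (κ : ℝ) (a : ℕ → ℂ) (L₂ : ℂ × ℂ → ℂ) : Prop :=
  IsMeromorphicTwo L₂ ∧ ∀ s₁ s₂ : ℂ, (κ + 1) / 2 < s₂.re → (κ + 3) / 2 < (s₁ + s₂).re →
    HasSum (termL₂ a s₁ s₂) (L₂ (s₁, s₂))

/-- `L₁` is the meromorphic function `Γ(1-s₁) Γ(s₁+s₂-1) / Γ(s₂) · L(s₁+s₂-1)` on `ℂ²`: it is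
given by this formula wherever no factor has a singularity (`1/Γ` is entire, and
`Complex.Gamma` is zero at its poles). -/
def IsL₁ (L : ℂ → ℂ) (L₁ : ℂ × ℂ → ℂ) : Prop :=
  IsMeromorphicTwo L₁ ∧ ∀ s₁ s₂ : ℂ, (∀ k : ℕ, 1 - s₁ ≠ -(k : ℂ)) →
    (∀ k : ℕ, s₁ + s₂ - 1 ≠ -(k : ℂ)) → AnalyticAt ℂ L (s₁ + s₂ - 1) →
    L₁ (s₁, s₂) = Complex.Gamma (1 - s₁) * Complex.Gamma (s₁ + s₂ - 1) / Complex.Gamma s₂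
      * L (s₁ + s₂ - 1)

end

/-!
The continuations are built explicitly. With `y = r/x` the function `Ψ(a,b;x)` becomes
`Γ(a)⁻¹ x^{-a} ∫_0^∞ e^{-r} r^{a-1} (1+r/x)^{b-a-1} dr` (`confluentPsi_eq_remInt`). Taking `N` terms
of the binomial series out of the last factor leaves a remainder which is holomorphic for
`Re a > -N` and `O(|x|^{-Re a-N})` on the imaginary axis (`exists_norm_remInt_le`,
`analyticAt_remInt`). Summed over `l = nk`, the extracted terms give products of the shape
`Γ(s₂+k) L(1-s₁+k) ζ(s₂+k)`, meromorphic on `ℂ²`, and the remainders give a series that is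
holomorphic for `Re s₁ < N + (1-κ)/2`, `Re s₂ > 1-N` (`analyticAt_tsum_termR`). The resulting
expressions for different `N` agree where both make sense (`partF_eq_of_le`), so they define `F_±`
on `ℂ²`. Joint analyticity of the integrals and series comes from Osgood's lemma
(`analyticAt_of_separately`).

If `Re s₁ < 0`, the function `u ↦ u^{-s₁} (n+u)^{-s₂}`, extended by `0` to `u ≤ 0`, is continuous,
and Poisson summation evaluates `∑_m m^{-s₁} (m+n)^{-s₂}` (`tsum_summand_eq`): the zero frequency is
a beta integral and yields `L₁`, while the frequencies `± k` are, up to the factor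
`n^{1-s₁-s₂} Γ(1-s₁)`, the values `Ψ(1-s₁,2-s₁-s₂; ±2πi nk)`, because the path of integration can be
turned from the positive axis to the ray used in `Ψ` (`laplaceInt_eq_remInt`). This proves the
identity where all the series converge (`tsum_termL₂_eq_rawL₂`). Its right-hand side is meromorphic
on `ℂ²`, so it provides the continuation of `L₂`; by the identity theorem it agrees with the double
series on the whole region of convergence, which is convex (`generic_rawL₂_eq`).

Values at singularities are dealt with once and for all: equality outside a proper analytic germ is
equality along the filter `genericAt p`, and `normalForm` removes the removable singularities of a
meromorphic function of two variables without changing it generically.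
-/

noncomputable section

/-! ### The filter of generic points and meromorphic functions of two variables -/

/-- An analytic germ that is not identically zero stays so at all points of a whole ball, on which
it is analytic. -/
theorem exists_ball_forall_not_eventually_zero {h : ℂ × ℂ → ℂ} {p : ℂ × ℂ}
    (hh : AnalyticAt ℂ h p) (h0 : ¬ ∀ᶠ z in 𝓝 p, h z = 0) :
    ∃ r > 0, AnalyticOnNhd ℂ h (Metric.ball p r) ∧
      ∀ q ∈ Metric.ball p r, ¬ ∀ᶠ z in 𝓝 q, h z = 0 := by
  obtain ⟨r, hr, hB⟩ := Metric.eventually_nhds_iff_ball.1 hh.eventually_analyticAt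
  refine ⟨r, hr, hB, fun q hq hq0 => h0 ?_⟩
  have := AnalyticOnNhd.eqOn_zero_of_preconnected_of_eventuallyEq_zero (f := h) hB
    (convex_ball p r).isPreconnected hq hq0
  filter_upwards [Metric.ball_mem_nhds p hr] with z hz using this hz

/-- The germs at `p` form an integral domain. -/
theorem eventually_zero_of_mul {h k : ℂ × ℂ → ℂ} {p : ℂ × ℂ}
    (hh : AnalyticAt ℂ h p) (hk : AnalyticAt ℂ k p) (h0 : ¬ ∀ᶠ z in 𝓝 p, h z = 0)
    (hm : ∀ᶠ z in 𝓝 p, h z ≠ 0 → k z = 0) : ∀ᶠ z in 𝓝 p, k z = 0 := by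
  obtain ⟨r, hr, hB⟩ := Metric.eventually_nhds_iff_ball.1
    (hk.eventually_analyticAt.and (hh.eventually_analyticAt.and hm))
  have hne : ∃ q ∈ Metric.ball p r, h q ≠ 0 := by
    by_contra! hcon
    exact h0 (by filter_upwards [Metric.ball_mem_nhds p hr] with z hz using hcon z hz)
  obtain ⟨q, hq, hq0⟩ := hne
  have hkq : k =ᶠ[𝓝 q] 0 := by
    filter_upwards [Metric.isOpen_ball.mem_nhds hq,
      (hB q hq).2.1.continuousAt.eventually_ne hq0] with z hz hz0 using (hB z hz).2.2 hz0
  have := AnalyticOnNhd.eqOn_zero_of_preconnected_of_eventuallyEq_zero (f := k)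
    (fun z hz => (hB z hz).1) (convex_ball p r).isPreconnected hq hkq
  filter_upwards [Metric.ball_mem_nhds p hr] with z hz using this hz

theorem not_eventually_zero_mul {h k : ℂ × ℂ → ℂ} {p : ℂ × ℂ}
    (hh : AnalyticAt ℂ h p) (hk : AnalyticAt ℂ k p) (h0 : ¬ ∀ᶠ z in 𝓝 p, h z = 0)
    (k0 : ¬ ∀ᶠ z in 𝓝 p, k z = 0) : ¬ ∀ᶠ z in 𝓝 p, h z * k z = 0 := fun hm =>
  k0 (eventually_zero_of_mul hh hk h0 (hm.mono fun z hz hz0 => by simpa [hz0] using hz))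

/-- The filter of sets that contain, near `p`, everything outside the zero set of a holomorphic
germ that does not vanish identically. Eventual equality along it is `GenericEqAt`. -/
def genericAt (p : ℂ × ℂ) : Filter (ℂ × ℂ) where
  sets := {S | ∃ h : ℂ × ℂ → ℂ, AnalyticAt ℂ h p ∧ ¬ (∀ᶠ z in 𝓝 p, h z = 0) ∧
    ∀ᶠ z in 𝓝 p, h z ≠ 0 → z ∈ S}
  univ_sets := ⟨fun _ => 1, analyticAt_const, fun hc => one_ne_zero hc.self_of_nhds, by simp⟩
  sets_of_superset := by
    rintro S T ⟨h, hh, h0, hS⟩ hST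
    exact ⟨h, hh, h0, hS.mono fun z hz hz0 => hST (hz hz0)⟩
  inter_sets := by
    rintro S T ⟨h, hh, h0, hS⟩ ⟨k, hk, k0, hT⟩
    refine ⟨fun z => h z * k z, hh.mul hk, not_eventually_zero_mul hh hk h0 k0, ?_⟩
    filter_upwards [hS, hT] with z h1 h2 h3
    exact ⟨h1 (left_ne_zero_of_mul h3), h2 (right_ne_zero_of_mul h3)⟩

theorem genericEqAt_iff {F G : ℂ × ℂ → ℂ} {p : ℂ × ℂ} :
    GenericEqAt F G p ↔ F =ᶠ[genericAt p] G := Iff.rfl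

theorem genericAt_le_nhds (p : ℂ × ℂ) : genericAt p ≤ 𝓝 p := fun _S hS =>
  ⟨fun _ => 1, analyticAt_const, fun hc => one_ne_zero hc.self_of_nhds, by
    filter_upwards [hS] with z hz _ using hz⟩

theorem eventually_genericAt_ne_zero {k : ℂ × ℂ → ℂ} {p : ℂ × ℂ} (hk : AnalyticAt ℂ k p)
    (k0 : ¬ ∀ᶠ z in 𝓝 p, k z = 0) : ∀ᶠ z in genericAt p, k z ≠ 0 :=
  ⟨k, hk, k0, by simp⟩

theorem eventually_eventually_genericAt {P : ℂ × ℂ → Prop} {p : ℂ × ℂ}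
    (hP : ∀ᶠ z in genericAt p, P z) : ∀ᶠ q in 𝓝 p, ∀ᶠ z in genericAt q, P z := by
  obtain ⟨h, hh, h0, hP⟩ := hP
  obtain ⟨r, hr, hB, hB0⟩ := exists_ball_forall_not_eventually_zero hh h0
  filter_upwards [Metric.ball_mem_nhds p hr, hP.eventually_nhds] with q hq hq'
  exact ⟨h, hB q hq, hB0 q hq, hq'⟩

/-- A property that holds generically holds near each generic point. -/
theorem eventually_genericAt_eventually_nhds {P : ℂ × ℂ → Prop} {p : ℂ × ℂ}
    (hP : ∀ᶠ z in genericAt p, P z) : ∀ᶠ z in genericAt p, ∀ᶠ w in 𝓝 z, P w := by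
  obtain ⟨h, hh, h0, hP⟩ := hP
  refine ⟨h, hh, h0, ?_⟩
  filter_upwards [hP.eventually_nhds, hh.eventually_analyticAt] with z hz hz' hz0
  filter_upwards [hz, hz'.continuousAt.eventually_ne hz0] with w h1 h2 using h1 h2

theorem eventually_nhds_eq_of_genericAt {F G : ℂ × ℂ → ℂ} {p : ℂ × ℂ} (hF : AnalyticAt ℂ F p)
    (hG : AnalyticAt ℂ G p) (h : F =ᶠ[genericAt p] G) : F =ᶠ[𝓝 p] G := by
  obtain ⟨h, hh, h0, hP⟩ := h
  have := eventually_zero_of_mul hh (hF.sub hG) h0 (hP.mono fun z hz hz0 => by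
    exact sub_eq_zero.2 (hz hz0))
  exact this.mono fun z hz => sub_eq_zero.1 hz

theorem eq_of_genericAt {F G : ℂ × ℂ → ℂ} {p : ℂ × ℂ} (hF : AnalyticAt ℂ F p)
    (hG : AnalyticAt ℂ G p) (h : F =ᶠ[genericAt p] G) : F p = G p :=
  (eventually_nhds_eq_of_genericAt hF hG h).self_of_nhds

theorem tendsto_genericAt {φ : ℂ × ℂ → ℂ × ℂ} {p : ℂ × ℂ} (hφ : AnalyticAt ℂ φ p)
    (ho : IsOpenMap φ) : Tendsto φ (genericAt p) (genericAt (φ p)) := by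
  rintro S ⟨h, hh, h0, hS⟩
  refine ⟨h ∘ φ, hh.comp hφ, fun hc => h0 (ho.nhds_le p hc), hφ.continuousAt.eventually hS⟩

theorem meromorphicAtTwo_iff {F : ℂ × ℂ → ℂ} {p : ℂ × ℂ} : MeromorphicAtTwo F p ↔
    ∃ g k : ℂ × ℂ → ℂ, AnalyticAt ℂ g p ∧ AnalyticAt ℂ k p ∧ ¬ (∀ᶠ z in 𝓝 p, k z = 0) ∧
      F =ᶠ[genericAt p] fun z => g z / k z := Iff.rfl

theorem AnalyticAt.meromorphicAtTwo {F : ℂ × ℂ → ℂ} {p : ℂ × ℂ} (hF : AnalyticAt ℂ F p) :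
    MeromorphicAtTwo F p :=
  meromorphicAtTwo_iff.2 ⟨F, fun _ => 1, hF, analyticAt_const,
    fun hc => one_ne_zero hc.self_of_nhds, Eventually.of_forall fun z => by simp⟩

theorem MeromorphicAtTwo.congr {F G : ℂ × ℂ → ℂ} {p : ℂ × ℂ} (hF : MeromorphicAtTwo F p)
    (h : F =ᶠ[genericAt p] G) : MeromorphicAtTwo G p := by
  obtain ⟨g, k, hg, hk, k0, e⟩ := hF
  exact ⟨g, k, hg, hk, k0, h.symm.trans e⟩

theorem MeromorphicAtTwo.add {F G : ℂ × ℂ → ℂ} {p : ℂ × ℂ} (hF : MeromorphicAtTwo F p)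
    (hG : MeromorphicAtTwo G p) : MeromorphicAtTwo (fun z => F z + G z) p := by
  obtain ⟨g, k, hg, hk, k0, e⟩ := meromorphicAtTwo_iff.1 hF
  obtain ⟨g', k', hg', hk', k0', e'⟩ := meromorphicAtTwo_iff.1 hG
  refine meromorphicAtTwo_iff.2 ⟨fun z => g z * k' z + k z * g' z, fun z => k z * k' z,
    (hg.mul hk').add (hk.mul hg'), hk.mul hk', not_eventually_zero_mul hk hk' k0 k0', ?_⟩
  filter_upwards [e, e', eventually_genericAt_ne_zero hk k0,
    eventually_genericAt_ne_zero hk' k0'] with z h1 h2 h3 h4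
  rw [h1, h2, div_add_div _ _ h3 h4]

theorem MeromorphicAtTwo.mul {F G : ℂ × ℂ → ℂ} {p : ℂ × ℂ} (hF : MeromorphicAtTwo F p)
    (hG : MeromorphicAtTwo G p) : MeromorphicAtTwo (fun z => F z * G z) p := by
  obtain ⟨g, k, hg, hk, k0, e⟩ := meromorphicAtTwo_iff.1 hF
  obtain ⟨g', k', hg', hk', k0', e'⟩ := meromorphicAtTwo_iff.1 hG
  refine meromorphicAtTwo_iff.2 ⟨fun z => g z * g' z, fun z => k z * k' z,
    hg.mul hg', hk.mul hk', not_eventually_zero_mul hk hk' k0 k0', ?_⟩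
  filter_upwards [e, e'] with z h1 h2
  rw [h1, h2, div_mul_div_comm]

theorem MeromorphicAtTwo.sum {ι : Type*} (s : Finset ι) {F : ι → ℂ × ℂ → ℂ} {p : ℂ × ℂ}
    (hF : ∀ i ∈ s, MeromorphicAtTwo (F i) p) :
    MeromorphicAtTwo (fun z => ∑ i ∈ s, F i z) p := by
  classical
  induction s using Finset.induction_on with
  | empty => simpa using (analyticAt_const (v := (0 : ℂ))).meromorphicAtTwo
  | insert i s hi ih =>
    simp only [Finset.sum_insert hi]
    exact (hF i (by simp)).add (ih fun j hj => hF j (by simp [hj]))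

theorem MeromorphicAtTwo.comp {F : ℂ × ℂ → ℂ} {φ : ℂ × ℂ → ℂ × ℂ} {p : ℂ × ℂ}
    (hF : MeromorphicAtTwo F (φ p)) (hφ : AnalyticAt ℂ φ p) (ho : IsOpenMap φ) :
    MeromorphicAtTwo (fun z => F (φ z)) p := by
  obtain ⟨g, k, hg, hk, k0, e⟩ := meromorphicAtTwo_iff.1 hF
  exact ⟨g ∘ φ, k ∘ φ, hg.comp hφ, hk.comp hφ, fun hc => k0 (ho.nhds_le p hc),
    (tendsto_genericAt hφ ho).eventually e⟩

/-- A meromorphic function of one variable, evaluated along an open holomorphic map, is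
meromorphic in two variables. -/
theorem MeromorphicAt.meromorphicAtTwo_comp {f : ℂ → ℂ} {φ : ℂ × ℂ → ℂ} {p : ℂ × ℂ}
    (hf : MeromorphicAt f (φ p)) (hφ : AnalyticAt ℂ φ p) (ho : IsOpenMap φ) :
    MeromorphicAtTwo (fun z => f (φ z)) p := by
  obtain ⟨n, hn⟩ := hf
  have hk : AnalyticAt ℂ (fun z => φ z - φ p) p := hφ.sub analyticAt_const
  have hk0 : ∀ m : ℕ, ¬ ∀ᶠ z in 𝓝 p, (φ z - φ p) ^ m = 0 := fun m hc => by
    have h1 : ∀ᶠ w in 𝓝 (φ p), (w - φ p) ^ m = 0 := ho.nhds_le p hc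
    have h2 : ∀ᶠ w in 𝓝[≠] (φ p), False := by
      filter_upwards [h1.filter_mono nhdsWithin_le_nhds, self_mem_nhdsWithin] with w hw hw'
      exact hw' (sub_eq_zero.1 (eq_zero_of_pow_eq_zero hw))
    exact h2.exists.choose_spec
  refine meromorphicAtTwo_iff.2 ⟨fun z => (φ z - φ p) ^ n • f (φ z), fun z => (φ z - φ p) ^ n,
    hn.comp hφ, hk.pow n, hk0 n, ?_⟩
  filter_upwards [eventually_genericAt_ne_zero (hk.pow n) (hk0 n)] with z hz
  have hz : (φ z - φ p) ^ n ≠ 0 := hz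
  simp [hz]

/-- The identity theorem for meromorphic functions of two variables. -/
theorem genericAt_eq_of_isPreconnected {F G : ℂ × ℂ → ℂ} {U : Set (ℂ × ℂ)}
    (hU : IsPreconnected U) (hF : ∀ p ∈ U, MeromorphicAtTwo F p)
    (hG : ∀ p ∈ U, MeromorphicAtTwo G p) {p₀ : ℂ × ℂ} (hp₀ : p₀ ∈ U)
    (h₀ : F =ᶠ[genericAt p₀] G) : ∀ p ∈ U, F =ᶠ[genericAt p] G := by
  refine hU.subset_of_closure_inter_subset (u := {p | F =ᶠ[genericAt p] G}) ?_ ⟨p₀, hp₀, h₀⟩ ?_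
  · exact isOpen_iff_mem_nhds.2 fun p hp => eventually_eventually_genericAt hp
  rintro p ⟨hpc, hpU⟩
  obtain ⟨g, k, hg, hk, k0, e⟩ := meromorphicAtTwo_iff.1 (hF p hpU)
  obtain ⟨g', k', hg', hk', k0', e'⟩ := meromorphicAtTwo_iff.1 (hG p hpU)
  have hkk := hk.mul hk'
  obtain ⟨r₁, hr₁, hB₁, hB₁0⟩ := exists_ball_forall_not_eventually_zero hkk
    (not_eventually_zero_mul hk hk' k0 k0')
  obtain ⟨r₂, hr₂, hB₂⟩ := Metric.eventually_nhds_iff_ball.1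
    (((hg.mul hk').sub (hk.mul hg')).eventually_analyticAt.and
      ((eventually_eventually_genericAt e).and (eventually_eventually_genericAt e')))
  have hr : 0 < min r₁ r₂ := lt_min hr₁ hr₂
  obtain ⟨q, hqu, hqB⟩ : ∃ q, q ∈ {p | F =ᶠ[genericAt p] G} ∧ q ∈ Metric.ball p (min r₁ r₂) := by
    obtain ⟨q, hq, hqd⟩ := Metric.mem_closure_iff.1 hpc _ hr
    exact ⟨q, hq, by rwa [Metric.mem_ball, dist_comm]⟩
  have hq₁ := Metric.ball_subset_ball (min_le_left _ _) hqB
  have hq₂ := Metric.ball_subset_ball (min_le_right _ _) hqB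
  have hzero : (fun z => g z * k' z - k z * g' z) =ᶠ[𝓝 q] 0 := by
    refine eventually_nhds_eq_of_genericAt (hB₂ q hq₂).1 analyticAt_const ?_
    filter_upwards [(hB₂ q hq₂).2.1, (hB₂ q hq₂).2.2, hqu,
      eventually_genericAt_ne_zero (hB₁ q hq₁) (hB₁0 q hq₁)] with z h1 h2 h3 h4
    rw [h3, h2] at h1
    have h5 : k z ≠ 0 := left_ne_zero_of_mul h4
    have h6 : k' z ≠ 0 := right_ne_zero_of_mul h4
    rw [div_eq_div_iff h6 h5] at h1
    simp only [Pi.zero_apply]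
    linear_combination -h1
  have hz := AnalyticOnNhd.eqOn_zero_of_preconnected_of_eventuallyEq_zero
    (fun z hz => (hB₂ z hz).1) (convex_ball p r₂).isPreconnected hq₂ hzero
  have hz' : ∀ᶠ z in genericAt p, g z * k' z - k z * g' z = 0 :=
    (genericAt_le_nhds p) (by
      filter_upwards [Metric.ball_mem_nhds p hr₂] with z h using hz h)
  show F =ᶠ[genericAt p] G
  filter_upwards [e, e', hz', eventually_genericAt_ne_zero hk k0,
    eventually_genericAt_ne_zero hk' k0'] with z h1 h2 h3 h4 h5
  rw [h1, h2, div_eq_div_iff h4 h5]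
  linear_combination h3

open Classical in
/-- `F` with its removable singularities removed, and with the value `0` at the remaining ones. -/
def normalForm (F : ℂ × ℂ → ℂ) (p : ℂ × ℂ) : ℂ :=
  if h : RegularAtTwo F p then h.choose p else 0

theorem normalForm_eq_of_generic {F g : ℂ × ℂ → ℂ} {p : ℂ × ℂ} (hg : AnalyticAt ℂ g p)
    (h : F =ᶠ[genericAt p] g) : normalForm F p = g p := by
  have hr : RegularAtTwo F p := ⟨g, hg, h⟩
  rw [normalForm, dif_pos hr]
  exact eq_of_genericAt hr.choose_spec.1 hg
    ((genericEqAt_iff.1 hr.choose_spec.2).symm.trans h)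

theorem normalForm_eq_of_analyticAt {F : ℂ × ℂ → ℂ} {p : ℂ × ℂ} (hF : AnalyticAt ℂ F p) :
    normalForm F p = F p :=
  normalForm_eq_of_generic hF EventuallyEq.rfl

theorem RegularAtTwo.analyticAt_normalForm {F : ℂ × ℂ → ℂ} {p : ℂ × ℂ}
    (h : RegularAtTwo F p) : AnalyticAt ℂ (normalForm F) p := by
  obtain ⟨g, hg, e⟩ := h
  refine hg.congr ?_
  filter_upwards [hg.eventually_analyticAt, eventually_eventually_genericAt e] with q h1 h2
  exact (normalForm_eq_of_generic h1 h2).symm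

theorem MeromorphicAtTwo.normalForm_eq {F : ℂ × ℂ → ℂ} {p : ℂ × ℂ}
    (h : MeromorphicAtTwo F p) : normalForm F =ᶠ[genericAt p] F := by
  obtain ⟨g, k, hg, hk, k0, e⟩ := meromorphicAtTwo_iff.1 h
  filter_upwards [eventually_genericAt_eventually_nhds e, eventually_genericAt_ne_zero hk k0,
    genericAt_le_nhds p hg.eventually_analyticAt,
    genericAt_le_nhds p hk.eventually_analyticAt] with z h1 h2 h3 h4
  exact normalForm_eq_of_analyticAt ((h3.div h4 h2).congr (EventuallyEq.symm h1))

theorem isMeromorphicTwo_normalForm {F : ℂ × ℂ → ℂ} (hF : ∀ p, MeromorphicAtTwo F p) :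
    IsMeromorphicTwo (normalForm F) := fun p =>
  ⟨(hF p).congr (hF p).normalForm_eq.symm, fun ⟨g, hg, e⟩ =>
    RegularAtTwo.analyticAt_normalForm ⟨g, hg, (hF p).normalForm_eq.symm.trans e⟩⟩

/-! ### Holomorphic functions of two variables: Osgood's lemma, integrals and series -/

/-- The Cauchy kernel in an algebra of continuous functions is analytic in the pole. -/
theorem analyticAt_ringInverse_sub_const {K : Type*} [TopologicalSpace K] [CompactSpace K]
    (ζ : C(K, ℂ)) {φ : ℂ × ℂ → ℂ} {p : ℂ × ℂ} (hφ : AnalyticAt ℂ φ p)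
    (h : ∀ t, ζ t ≠ φ p) :
    AnalyticAt ℂ (fun z => Ring.inverse (ζ - φ z • (1 : C(K, ℂ)))) p := by
  have hu : IsUnit (ζ - φ p • (1 : C(K, ℂ))) := by
    rw [ContinuousMap.isUnit_iff_forall_ne_zero]
    intro t
    simpa [sub_eq_zero] using h t
  obtain ⟨u, hu⟩ := hu
  have h1 : AnalyticAt ℂ (fun z => ζ - φ z • (1 : C(K, ℂ))) p := by
    refine analyticAt_const.sub ?_
    exact hφ.smul analyticAt_const
  have h2 : AnalyticAt ℂ Ring.inverse ((fun z => ζ - φ z • (1 : C(K, ℂ))) p) := by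
    have := analyticAt_inverse (𝕜 := ℂ) u
    rwa [hu] at this
  exact AnalyticAt.comp (g := Ring.inverse) h2 h1

theorem ringInverse_apply {K : Type*} [TopologicalSpace K] [CompactSpace K]
    (g : C(K, ℂ)) (h : ∀ t, g t ≠ 0) (t : K) : (Ring.inverse g) t = (g t)⁻¹ := by
  have hu : IsUnit g := by
    rw [ContinuousMap.isUnit_iff_forall_ne_zero]; exact h
  have := congrArg (fun f : C(K, ℂ) => f t) (Ring.inverse_mul_cancel g hu)
  simp only [ContinuousMap.mul_apply, ContinuousMap.one_apply] at this
  exact eq_inv_of_mul_eq_one_left this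

open MeasureTheory in
/-- Integration against a finite measure, as a continuous functional on continuous functions. -/
def integralFunctional {K : Type*} [TopologicalSpace K] [CompactSpace K]
    [MeasurableSpace K] [OpensMeasurableSpace K] (μ : Measure K) [IsFiniteMeasure μ] :
    C(K, ℂ) →L[ℂ] ℂ :=
  LinearMap.mkContinuous
    { toFun := fun g => ∫ t, g t ∂μ
      map_add' := fun g h => by
        have hi : ∀ g : C(K, ℂ), Integrable (fun t => g t) μ := fun g =>
          Integrable.of_bound g.continuous.aestronglyMeasurable ‖g‖
            (Eventually.of_forall fun t => g.norm_coe_le_norm t)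
        exact integral_add (hi g) (hi h)
      map_smul' := fun c g => integral_smul c _ } (μ.real Set.univ)
    (fun g => by
      have := norm_integral_le_of_norm_le_const (μ := μ) (f := fun t => g t)
        (Eventually.of_forall fun t => g.norm_coe_le_norm t)
      simpa [mul_comm] using this)

open MeasureTheory Set in
/-- **Osgood's lemma**: a continuous function of two variables that is holomorphic in each of them
is jointly analytic. The double Cauchy integral over a torus is a continuous linear functional of
an analytic function with values in the Banach algebra of continuous functions on the torus. -/
theorem analyticAt_of_separately {f : ℂ × ℂ → ℂ} {U : Set (ℂ × ℂ)} (hU : IsOpen U)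
    (hc : ContinuousOn f U) (h₁ : ∀ p ∈ U, DifferentiableAt ℂ (fun z => f (z, p.2)) p.1)
    (h₂ : ∀ p ∈ U, DifferentiableAt ℂ (fun w => f (p.1, w)) p.2) {p : ℂ × ℂ} (hp : p ∈ U) :
    AnalyticAt ℂ f p := by
  obtain ⟨r₀, hr₀, hB⟩ := Metric.isOpen_iff.1 hU p hp
  obtain ⟨r, hr, hrr⟩ := exists_between hr₀
  have hB' : ∀ z ∈ Metric.closedBall p.1 r, ∀ w ∈ Metric.closedBall p.2 r, (z, w) ∈ U := by
    intro z hz w hw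
    apply hB
    rw [Metric.mem_ball, Prod.dist_eq]
    exact max_lt (lt_of_le_of_lt hz hrr) (lt_of_le_of_lt hw hrr)
  let T := Icc (0 : ℝ) (2 * Real.pi)
  let μ : Measure T := Measure.comap Subtype.val volume
  have : IsFiniteMeasure μ := by
    refine ⟨?_⟩
    rw [Measure.comap_apply _ Subtype.val_injective (fun s hs =>
      measurableSet_Icc.subtype_image hs) _ MeasurableSet.univ]
    rw [Set.image_univ, Subtype.range_coe]
    exact measure_Icc_lt_top
  let ζ₁ : C(T × T, ℂ) := ⟨fun t => circleMap p.1 r t.1, by fun_prop⟩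
  let ζ₂ : C(T × T, ℂ) := ⟨fun t => circleMap p.2 r t.2, by fun_prop⟩
  let δ : C(T × T, ℂ) := ⟨fun t => deriv (circleMap p.1 r) t.1 * deriv (circleMap p.2 r) t.2, by
    simp only [deriv_circleMap]; fun_prop⟩
  let u : C(T × T, ℂ) := ⟨fun t => f (ζ₁ t, ζ₂ t), hc.comp_continuous (by fun_prop) fun t =>
    hB' _ (circleMap_mem_closedBall _ hr.le _) _ (circleMap_mem_closedBall _ hr.le _)⟩
  let I := integralFunctional (μ.prod μ)
  let g : ℂ × ℂ → ℂ := fun z => (2 * Real.pi * Complex.I)⁻¹ * (2 * Real.pi * Complex.I)⁻¹ *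
    I (δ * u * Ring.inverse (ζ₁ - z.1 • (1 : C(T × T, ℂ))) *
      Ring.inverse (ζ₂ - z.2 • (1 : C(T × T, ℂ))))
  have hne : ∀ c z : ℂ, z ∈ Metric.ball c r → ∀ t : ℝ, circleMap c r t ≠ z := by
    intro c z hz t h
    have := circleMap_mem_sphere c hr.le t
    rw [h] at this
    exact absurd (Metric.mem_ball.1 hz) (by rw [Metric.mem_sphere.1 this]; exact lt_irrefl _)
  have hg : AnalyticAt ℂ g p := by
    refine analyticAt_const.mul ((I.analyticAt _).comp ?_)
    refine (analyticAt_const.mul (analyticAt_ringInverse_sub_const ζ₁ analyticAt_fst ?_)).mul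
      (analyticAt_ringInverse_sub_const ζ₂ analyticAt_snd ?_)
    · exact fun t => hne p.1 p.1 (Metric.mem_ball_self hr) t.1
    · exact fun t => hne p.2 p.2 (Metric.mem_ball_self hr) t.2
  refine hg.congr ?_
  filter_upwards [Metric.ball_mem_nhds p hr] with z hz
  have hz1 : z.1 ∈ Metric.ball p.1 r := by
    rw [Metric.mem_ball, Prod.dist_eq] at hz; exact lt_of_le_of_lt (le_max_left _ _) hz
  have hz2 : z.2 ∈ Metric.ball p.2 r := by
    rw [Metric.mem_ball, Prod.dist_eq] at hz; exact lt_of_le_of_lt (le_max_right _ _) hz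
  have hμ : ∀ F : ℝ → ℂ, ∫ t : T, F t ∂μ = ∫ t in (0 : ℝ)..(2 * Real.pi), F t := by
    intro F
    rw [intervalIntegral.integral_of_le (by positivity), ← integral_Icc_eq_integral_Ioc]
    exact integral_subtype_comap measurableSet_Icc F
  have hI : I (δ * u * Ring.inverse (ζ₁ - z.1 • (1 : C(T × T, ℂ))) *
      Ring.inverse (ζ₂ - z.2 • (1 : C(T × T, ℂ)))) =
      ∮ x in C(p.1, r), (x - z.1)⁻¹ • ∮ y in C(p.2, r), (y - z.2)⁻¹ • f (x, y) := by
    have e1 : ∀ G : C(T × T, ℂ), I G = ∫ t : T, ∫ s : T, G (t, s) ∂μ ∂μ := by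
      intro G
      refine integral_prod (fun t => G t) ?_
      exact Integrable.of_bound G.continuous.aestronglyMeasurable ‖G‖
            (Eventually.of_forall fun t => G.norm_coe_le_norm t)
    rw [e1, circleIntegral, ← hμ]
    refine integral_congr_ae (Eventually.of_forall fun t => ?_)
    simp only [circleIntegral]
    rw [← hμ, ← integral_smul, ← integral_smul]
    refine integral_congr_ae (Eventually.of_forall fun s => ?_)
    simp only [ContinuousMap.mul_apply]
    rw [ringInverse_apply, ringInverse_apply]
    · simp only [δ, u, ζ₁, ζ₂, ContinuousMap.coe_mk, ContinuousMap.sub_apply, smul_eq_mul,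
        ContinuousMap.smul_apply, ContinuousMap.one_apply, mul_one]
      ring
    · intro t
      simpa [ζ₂, sub_eq_zero] using hne p.2 z.2 hz2 t.2
    · intro t
      simpa [ζ₁, sub_eq_zero] using hne p.1 z.1 hz1 t.1
  have hin : ∀ x ∈ Metric.closedBall p.1 r,
      ∮ y in C(p.2, r), (y - z.2)⁻¹ • f (x, y) = (2 * Real.pi * Complex.I) • f (x, z.2) := by
    intro x hx
    refine DifferentiableOn.circleIntegral_sub_inv_smul (f := fun y => f (x, y))
      (fun y hy => (h₂ (x, y) (hB' x hx y hy)).differentiableWithinAt) hz2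
  have hout : ∮ x in C(p.1, r), (x - z.1)⁻¹ • f (x, z.2) = (2 * Real.pi * Complex.I) • f z :=
    DifferentiableOn.circleIntegral_sub_inv_smul (f := fun x => f (x, z.2))
      (fun x hx => (h₁ (x, z.2) (hB' x hx z.2
        (Metric.ball_subset_closedBall hz2))).differentiableWithinAt) hz1
  have hmid : ∮ x in C(p.1, r), (x - z.1)⁻¹ • ∮ y in C(p.2, r), (y - z.2)⁻¹ • f (x, y) =
      (2 * Real.pi * Complex.I) • ∮ x in C(p.1, r), (x - z.1)⁻¹ • f (x, z.2) := by
    rw [← circleIntegral.integral_smul]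
    refine circleIntegral.integral_congr hr.le fun x hx => ?_
    rw [hin x (Metric.sphere_subset_closedBall hx), smul_comm]
  have h2pi : (2 * Real.pi * Complex.I : ℂ) ≠ 0 := Complex.two_pi_I_ne_zero
  simp only [g]
  rw [hI, hmid, hout]
  simp only [smul_eq_mul]
  field_simp

open MeasureTheory Set in
/-- Integrals of dominated families of holomorphic functions of one variable are holomorphic. -/
theorem differentiableAt_integral {α : Type*} [MeasurableSpace α] {μ : Measure α}
    {f : ℂ → α → ℂ} {U : Set ℂ} {bound : α → ℝ} {z₀ : ℂ} (hU : U ∈ 𝓝 z₀)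
    (hm : ∀ z ∈ U, AEStronglyMeasurable (f z) μ) (hi : Integrable bound μ)
    (hb : ∀ᵐ t ∂μ, ∀ z ∈ U, ‖f z t‖ ≤ bound t)
    (hd : ∀ᵐ t ∂μ, ∀ z ∈ U, DifferentiableAt ℂ (fun z => f z t) z) :
    DifferentiableAt ℂ (fun z => ∫ t, f z t ∂μ) z₀ := by
  obtain ⟨r, hr, hB⟩ := Metric.mem_nhds_iff.1 hU
  have hr2 : 0 < r / 2 := by positivity
  have hr4 : 0 < r / 4 := by positivity
  have hz₀ : z₀ ∈ U := mem_of_mem_nhds hU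
  have hsub : ∀ z ∈ Metric.ball z₀ (r / 2), Metric.closedBall z (r / 4) ⊆ U := by
    intro z hz w hw
    refine hB ?_
    have h1 := dist_triangle w z z₀
    rw [Metric.mem_ball] at hz ⊢
    rw [Metric.mem_closedBall] at hw
    linarith
  refine (hasDerivAt_integral_of_dominated_loc_of_deriv_le (μ := μ) (F := f)
    (F' := fun z t => deriv (fun z => f z t) z) (x₀ := z₀) (s := Metric.ball z₀ (r / 2))
    (bound := fun t => bound t / (r / 4)) (Metric.ball_mem_nhds z₀ hr2) ?_ ?_ ?_ ?_ ?_ ?_).2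
    |>.differentiableAt
  · filter_upwards [hU] with z hz using hm z hz
  · refine hi.mono' (hm z₀ hz₀) ?_
    filter_upwards [hb] with t ht using ht z₀ hz₀
  -- Measurability of the derivative at `z₀` in `t`: it is a limit of difference quotients.
  · let h : ℕ → ℂ := fun n => ((r / (2 * ((n : ℝ) + 1)) : ℝ) : ℂ)
    have hh0 : ∀ n, h n ≠ 0 := fun n => by
      simp only [h, ne_eq, Complex.ofReal_eq_zero]; positivity
    have hlim0 : Tendsto (fun n : ℕ => r / (2 * ((n : ℝ) + 1))) atTop (𝓝 0) := by
      refine Tendsto.const_div_atTop ?_ _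
      exact Tendsto.const_mul_atTop (by norm_num)
        (tendsto_atTop_add_const_right _ _ tendsto_natCast_atTop_atTop)
    have hlim : Tendsto h atTop (𝓝[≠] 0) := by
      refine tendsto_nhdsWithin_iff.2 ⟨?_, Eventually.of_forall hh0⟩
      have := (Complex.continuous_ofReal.tendsto 0).comp hlim0
      simpa [h, Function.comp_def] using this
    have hin : ∀ n, z₀ + h n ∈ U := fun n => hB (by
      rw [Metric.mem_ball, dist_eq_norm, add_sub_cancel_left]
      simp only [h, Complex.norm_real, Real.norm_eq_abs]
      rw [abs_of_pos (by positivity), div_lt_iff₀ (by positivity)]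
      have : (0 : ℝ) ≤ n := Nat.cast_nonneg n
      nlinarith)
    have hms : ∀ n, AEStronglyMeasurable (fun t => (h n)⁻¹ • (f (z₀ + h n) t - f z₀ t)) μ :=
      fun n => ((hm _ (hin n)).sub (hm _ hz₀)).const_smul (h n)⁻¹
    refine aestronglyMeasurable_of_tendsto_ae atTop
      (f := fun n t => (h n)⁻¹ • (f (z₀ + h n) t - f z₀ t))
      hms ?_
    filter_upwards [hd] with t ht
    exact (hasDerivAt_iff_tendsto_slope_zero.1 (ht z₀ hz₀).hasDerivAt).comp hlim
  · filter_upwards [hb, hd] with t hbt hdt z hz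
    refine Complex.norm_deriv_le_of_forall_mem_sphere_norm_le hr4 ?_ fun w hw =>
      hbt w (hsub z hz (Metric.sphere_subset_closedBall hw))
    refine DifferentiableOn.diffContOnCl fun w hw => (hdt w ?_).differentiableWithinAt
    rw [closure_ball _ hr4.ne'] at hw
    exact hsub z hz hw
  · exact hi.div_const _
  · filter_upwards [hd] with t hdt z hz
    refine (hdt z (hsub z hz (Metric.mem_closedBall_self hr4.le))).hasDerivAt

open MeasureTheory Set in
/-- Integrals of dominated families of holomorphic functions of two variables are holomorphic. -/
theorem analyticAt_integral {α : Type*} [MeasurableSpace α] {μ : Measure α}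
    {f : ℂ × ℂ → α → ℂ} {U : Set (ℂ × ℂ)} {bound : α → ℝ} (hU : IsOpen U)
    (hm : ∀ z ∈ U, AEStronglyMeasurable (f z) μ) (hi : Integrable bound μ)
    (hb : ∀ᵐ t ∂μ, ∀ z ∈ U, ‖f z t‖ ≤ bound t)
    (hd : ∀ᵐ t ∂μ, AnalyticOnNhd ℂ (fun z => f z t) U) :
    AnalyticOnNhd ℂ (fun z => ∫ t, f z t ∂μ) U := by
  intro p hp
  refine analyticAt_of_separately hU ?_ ?_ ?_ hp
  · intro q hq
    refine (continuousAt_of_dominated (bound := bound) ?_ ?_ hi ?_).continuousWithinAt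
    · filter_upwards [hU.mem_nhds hq] with z hz using hm z hz
    · filter_upwards [hU.mem_nhds hq] with z hz
      filter_upwards [hb] with t ht using ht z hz
    · filter_upwards [hd] with t ht using (ht q hq).continuousAt
  · intro q hq
    have hV : (fun z : ℂ => (z, q.2)) ⁻¹' U ∈ 𝓝 q.1 :=
      (by fun_prop : Continuous fun z : ℂ => (z, q.2)).continuousAt.preimage_mem_nhds
        (hU.mem_nhds hq)
    refine differentiableAt_integral (f := fun z t => f (z, q.2) t) hV
      (fun z hz => hm _ hz) hi ?_ ?_
    · filter_upwards [hb] with t ht z hz using ht _ hz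
    · filter_upwards [hd] with t ht z hz
      exact (ht _ hz).differentiableAt.comp z
        (by fun_prop : DifferentiableAt ℂ (fun z => (z, q.2)) z)
  · intro q hq
    have hV : (fun z : ℂ => (q.1, z)) ⁻¹' U ∈ 𝓝 q.2 :=
      (by fun_prop : Continuous fun z : ℂ => (q.1, z)).continuousAt.preimage_mem_nhds
        (hU.mem_nhds hq)
    refine differentiableAt_integral (f := fun z t => f (q.1, z) t) hV
      (fun z hz => hm _ hz) hi ?_ ?_
    · filter_upwards [hb] with t ht z hz using ht _ hz
    · filter_upwards [hd] with t ht z hz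
      exact (ht _ hz).differentiableAt.comp z
        (by fun_prop : DifferentiableAt ℂ (fun z => (q.1, z)) z)

/-- Normally convergent series of holomorphic functions of two variables are holomorphic. -/
theorem analyticOnNhd_tsum {ι : Type*} {F : ι → ℂ × ℂ → ℂ} {u : ι → ℝ} {U : Set (ℂ × ℂ)}
    (hU : IsOpen U) (hu : Summable u) (hF : ∀ i, AnalyticOnNhd ℂ (F i) U)
    (hb : ∀ i, ∀ z ∈ U, ‖F i z‖ ≤ u i) :
    AnalyticOnNhd ℂ (fun z => ∑' i, F i z) U := by
  intro p hp
  refine analyticAt_of_separately hU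
    (continuousOn_tsum (fun i => (hF i).continuousOn) hu hb) ?_ ?_ hp
  · intro q hq
    have hV : IsOpen ((fun z : ℂ => (z, q.2)) ⁻¹' U) := hU.preimage (by fun_prop)
    refine (Complex.differentiableOn_tsum_of_summable_norm (F := fun i z => F i (z, q.2)) hu
      (fun i z hz => ?_) hV (fun i z hz => hb i _ hz)).differentiableAt (hV.mem_nhds hq)
    exact ((hF i _ hz).differentiableAt.comp z
      (by fun_prop : DifferentiableAt ℂ (fun z => (z, q.2)) z)).differentiableWithinAt
  · intro q hq
    have hV : IsOpen ((fun z : ℂ => (q.1, z)) ⁻¹' U) := hU.preimage (by fun_prop)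
    refine (Complex.differentiableOn_tsum_of_summable_norm (F := fun i z => F i (q.1, z)) hu
      (fun i z hz => ?_) hV (fun i z hz => hb i _ hz)).differentiableAt (hV.mem_nhds hq)
    exact ((hF i _ hz).differentiableAt.comp z
      (by fun_prop : DifferentiableAt ℂ (fun z => (q.1, z)) z)).differentiableWithinAt

/-! ### Taylor remainders of the binomial series -/

/-- The generalized binomial coefficient `c (c-1) ⋯ (c-k+1) / k!`. -/
def binomCoeff (c : ℂ) (k : ℕ) : ℂ := (∏ j ∈ Finset.range k, (c - j)) / (k.factorial : ℂ)

theorem binomCoeff_zero (c : ℂ) : binomCoeff c 0 = 1 := by simp [binomCoeff]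

theorem binomCoeff_succ (c : ℂ) (k : ℕ) :
    binomCoeff c (k + 1) * (k + 1) = c * binomCoeff (c - 1) k := by
  have h : ∏ j ∈ Finset.range (k + 1), (c - j) = c * ∏ j ∈ Finset.range k, (c - 1 - j) := by
    rw [Finset.prod_range_succ', mul_comm]
    congr 1
    · simp
    · refine Finset.prod_congr rfl fun j _ => ?_
      push_cast; ring
  have h1 : ((k : ℂ) + 1) ≠ 0 := Nat.cast_add_one_ne_zero k
  have h2 : (k.factorial : ℂ) ≠ 0 := Nat.cast_ne_zero.2 k.factorial_ne_zero
  rw [binomCoeff, binomCoeff, h, Nat.factorial_succ]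
  push_cast
  field_simp

theorem analyticAt_binomCoeff (k : ℕ) (c : ℂ) : AnalyticAt ℂ (fun c => binomCoeff c k) c := by
  have : Differentiable ℂ fun c => binomCoeff c k := by
    unfold binomCoeff
    fun_prop
  exact this.analyticAt c

/-- The remainder `(1+y)^c - ∑_{k<N} binom(c,k) y^k` of the binomial series. -/
def taylorRem (N : ℕ) (c y : ℂ) : ℂ :=
  (1 + y) ^ c - ∑ k ∈ Finset.range N, binomCoeff c k * y ^ k

theorem taylorRem_succ_zero (N : ℕ) (c : ℂ) : taylorRem (N + 1) c 0 = 0 := by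
  simp [taylorRem, Finset.sum_range_succ', binomCoeff_zero]

theorem taylorRem_eq_add (N : ℕ) (c y : ℂ) :
    taylorRem N c y = binomCoeff c N * y ^ N + taylorRem (N + 1) c y := by
  simp only [taylorRem, Finset.sum_range_succ]; ring

theorem one_add_mem_slitPlane {y : ℂ} (hy : 0 ≤ y.re) : 1 + y ∈ Complex.slitPlane := by
  left; simp; linarith

theorem hasDerivAt_taylorRem_succ (N : ℕ) (c : ℂ) {y : ℂ} (hy : 0 ≤ y.re) :
    HasDerivAt (taylorRem (N + 1) c) (c * taylorRem N (c - 1) y) y := by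
  have h1 : HasDerivAt (fun y : ℂ => (1 + y) ^ c) (c * (1 + y) ^ (c - 1) * 1) y :=
    ((hasDerivAt_id y).const_add 1).cpow_const (one_add_mem_slitPlane hy)
  have h2 : HasDerivAt (fun y : ℂ => ∑ k ∈ Finset.range N, binomCoeff c (k + 1) * y ^ (k + 1))
      (∑ k ∈ Finset.range N, binomCoeff c (k + 1) * (((k + 1 : ℕ) : ℂ) * y ^ k)) y := by
    refine HasDerivAt.fun_sum fun k _ => ?_
    simpa using (hasDerivAt_pow (k + 1) y).const_mul (binomCoeff c (k + 1))
  have h3 := (h1.sub h2).sub_const 1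
  have e1 : taylorRem (N + 1) c = fun y => (1 + y) ^ c -
      ∑ k ∈ Finset.range N, binomCoeff c (k + 1) * y ^ (k + 1) - 1 := by
    funext y
    simp [taylorRem, Finset.sum_range_succ', binomCoeff_zero]
    ring
  rw [e1]
  convert! h3 using 1
  rw [taylorRem, mul_sub, Finset.mul_sum, mul_one]
  congr 1
  refine Finset.sum_congr rfl fun k _ => ?_
  rw [← mul_assoc, ← binomCoeff_succ]
  push_cast
  ring

theorem norm_one_add_cpow_le {y : ℂ} (hy : 0 ≤ y.re) (c : ℂ) :
    ‖(1 + y) ^ c‖ ≤ ‖1 + y‖ ^ c.re * Real.exp (Real.pi * ‖c‖) := by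
  have h0 : 1 + y ≠ 0 := Complex.slitPlane_ne_zero (one_add_mem_slitPlane hy)
  rw [Complex.norm_cpow_of_ne_zero h0, div_eq_mul_inv, ← Real.exp_neg]
  gcongr
  have h1 := Complex.abs_arg_le_pi (1 + y)
  have h2 := Complex.abs_im_le_norm c
  calc -((1 + y).arg * c.im) ≤ |(1 + y).arg * c.im| := neg_le_abs _
    _ = |(1 + y).arg| * |c.im| := abs_mul _ _
    _ ≤ _ := by gcongr

/-- Uniform bound for the remainder of the binomial series in the right half-plane, by induction on
`N` through the mean value inequality on `[0, y]`. -/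
theorem exists_norm_taylorRem_le (N : ℕ) : ∀ B : ℝ, 0 ≤ B → ∃ C : ℝ, 0 ≤ C ∧ ∃ M : ℕ,
    ∀ c : ℂ, ‖c‖ ≤ B → ∀ y : ℂ, 0 ≤ y.re →
      ‖taylorRem N c y‖ ≤ C * ‖y‖ ^ N * (1 + ‖y‖) ^ M := by
  induction N with
  | zero =>
    intro B hB
    refine ⟨Real.exp (Real.pi * B), (Real.exp_pos _).le, ⌈B⌉₊, fun c hc y hy => ?_⟩
    have h1 : 1 ≤ ‖1 + y‖ := by
      have := Complex.re_le_norm (1 + y)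
      simp at this; linarith
    have h2 : ‖1 + y‖ ≤ 1 + ‖y‖ := by simpa using norm_add_le 1 y
    simp only [taylorRem, Finset.range_zero, Finset.sum_empty, sub_zero, pow_zero, mul_one]
    calc ‖(1 + y) ^ c‖ ≤ ‖1 + y‖ ^ c.re * Real.exp (Real.pi * ‖c‖) := norm_one_add_cpow_le hy c
      _ ≤ ‖1 + y‖ ^ (⌈B⌉₊ : ℝ) * Real.exp (Real.pi * B) := by
          gcongr
          · exact ((Complex.re_le_norm c).trans hc).trans (Nat.le_ceil B)
      _ = ‖1 + y‖ ^ ⌈B⌉₊ * Real.exp (Real.pi * B) := by rw [Real.rpow_natCast]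
      _ ≤ (1 + ‖y‖) ^ ⌈B⌉₊ * Real.exp (Real.pi * B) := by gcongr
      _ = _ := mul_comm _ _
  | succ N ih =>
    intro B hB
    obtain ⟨C, hC, M, h⟩ := ih (B + 1) (by linarith)
    refine ⟨B * C, by positivity, M, fun c hc y hy => ?_⟩
    have hc' : ‖c - 1‖ ≤ B + 1 := (norm_sub_le c 1).trans (by simpa using hc)
    have hconv : Convex ℝ ({z : ℂ | 0 ≤ z.re} ∩ Metric.closedBall 0 ‖y‖) :=
      (convex_halfSpace_re_ge 0).inter (convex_closedBall _ _)
    have key := hconv.norm_image_sub_le_of_norm_hasDerivWithin_le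
      (f := taylorRem (N + 1) c) (f' := fun y => c * taylorRem N (c - 1) y)
      (C := B * (C * ‖y‖ ^ N * (1 + ‖y‖) ^ M)) (x := 0) (y := y)
      (fun z hz => (hasDerivAt_taylorRem_succ N c hz.1).hasDerivWithinAt)
      (fun z hz => by
        have hzy : ‖z‖ ≤ ‖y‖ := by simpa using hz.2
        rw [norm_mul]
        refine mul_le_mul hc ((h (c - 1) hc' z hz.1).trans ?_) (norm_nonneg _) hB
        gcongr)
      (by simp) (by simpa using hy)
    rw [taylorRem_succ_zero, sub_zero, sub_zero] at key
    calc _ ≤ _ := key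
      _ = _ := by ring

/-! ### The confluent hypergeometric integral and its remainders -/

/-- The integrand of `remInt`. -/
def remIntegrand (N : ℕ) (a c w : ℂ) (r : ℝ) : ℂ :=
  (Real.exp (-r) : ℂ) * (r : ℂ) ^ (a - 1) * taylorRem N c (r * w)

/-- `w^a ∫_0^∞ e^{-r} r^{a-1} ρ_N(c, r w) dr`, where `ρ_N(c,·)` is the `N`-th remainder of the
binomial series for `(1+y)^c`. At `w = 1/x` it is `Γ(a)` times the `N`-th remainder of the
asymptotic expansion of `Ψ(a,a+c+1;x)`. -/
def remInt (N : ℕ) (a c w : ℂ) : ℂ :=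
  w ^ a * ∫ r in Set.Ioi (0 : ℝ), remIntegrand N a c w r

theorem ofReal_mul_cpow {t : ℝ} (ht : 0 < t) {z : ℂ} (hz : z ≠ 0) (a : ℂ) :
    ((t : ℂ) * z) ^ a = (t : ℂ) ^ a * z ^ a := by
  have ht' : (t : ℂ) ≠ 0 := by exact_mod_cast ht.ne'
  rw [Complex.cpow_def_of_ne_zero (mul_ne_zero ht' hz), Complex.cpow_def_of_ne_zero ht',
    Complex.cpow_def_of_ne_zero hz, Complex.log_ofReal_mul ht hz, ← Complex.exp_add,
    Complex.ofReal_log ht.le, add_mul]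

open MeasureTheory Set in
theorem confluentPsi_eq_remInt (a b : ℂ) {x : ℂ} (hx : x ≠ 0) :
    confluentPsi a b x = (Complex.Gamma a)⁻¹ * remInt 0 a (b - a - 1) x⁻¹ := by
  have hx0 : 0 < ‖x‖ := norm_pos_iff.2 hx
  have hxn : (‖x‖ : ℂ) ≠ 0 := by exact_mod_cast hx0.ne'
  have hφ : Complex.exp ((-Complex.arg x : ℝ) * Complex.I) = ‖x‖ * x⁻¹ := by
    have h := Complex.norm_mul_exp_arg_mul_I x
    push_cast
    rw [neg_mul, Complex.exp_neg]
    have h2 : Complex.exp (Complex.arg x * Complex.I) = x / ‖x‖ := by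
      rw [eq_div_iff hxn, mul_comm]; exact h
    rw [h2, inv_div, div_eq_mul_inv]
  rw [confluentPsi, confluentPsiRay, remInt, hφ]
  congr 1
  let g : ℝ → ℂ := fun r => x⁻¹ ^ a * remIntegrand 0 a (b - a - 1) x⁻¹ r
  have hg : ∀ r ∈ Ioi (0 : ℝ), Complex.exp (-x * (r * (‖x‖ * x⁻¹)))
      * (r * (‖x‖ * x⁻¹)) ^ (a - 1) * (r * (‖x‖ * x⁻¹) + 1) ^ (b - a - 1)
      * (‖x‖ * x⁻¹) = ‖x‖ • g (‖x‖ * r) := by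
    intro r hr
    have hr : 0 < r := hr
    have e1 : -x * (r * (‖x‖ * x⁻¹)) = ((-(‖x‖ * r) : ℝ) : ℂ) := by
      push_cast; field_simp
    have e2 : (r * (‖x‖ * x⁻¹)) ^ (a - 1) = ((‖x‖ * r : ℝ) : ℂ) ^ (a - 1) * (x⁻¹ ^ a * x) := by
      have : (r * (‖x‖ * x⁻¹) : ℂ) = ((‖x‖ * r : ℝ) : ℂ) * x⁻¹ := by push_cast; ring
      rw [this, ofReal_mul_cpow (mul_pos hx0 hr) (inv_ne_zero hx),
        Complex.cpow_sub _ _ (inv_ne_zero hx), Complex.cpow_one, div_inv_eq_mul]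
    rw [e1, e2]
    simp only [g, remIntegrand, taylorRem, Finset.range_zero, Finset.sum_empty, sub_zero]
    rw [Complex.real_smul, Complex.ofReal_exp,
      show (r * (‖x‖ * x⁻¹) + 1 : ℂ) = 1 + ((‖x‖ * r : ℝ) : ℂ) * x⁻¹ by push_cast; ring]
    field_simp
  rw [setIntegral_congr_fun measurableSet_Ioi hg, integral_smul,
    integral_comp_mul_left_Ioi g 0 hx0, mul_zero, smul_smul, mul_inv_cancel₀ hx0.ne', one_smul]
  exact integral_const_mul _ _

theorem continuousOn_remIntegrand (N : ℕ) (a c : ℂ) {w : ℂ} (hw : 0 ≤ w.re) :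
    ContinuousOn (remIntegrand N a c w) (Set.Ioi 0) := by
  intro r hr
  have hr : 0 < r := hr
  have h1 : (r : ℂ) ∈ Complex.slitPlane := Or.inl (by simpa using hr)
  have h2 : 1 + (r : ℂ) * w ∈ Complex.slitPlane :=
    one_add_mem_slitPlane (by simpa using mul_nonneg hr.le hw)
  refine ContinuousAt.continuousWithinAt ?_
  unfold remIntegrand taylorRem
  refine (ContinuousAt.mul (by fun_prop) ?_).mul (ContinuousAt.sub ?_ (by fun_prop))
  · exact (continuousAt_cpow_const h1).comp Complex.continuous_ofReal.continuousAt
  · exact ContinuousAt.comp (f := fun r : ℝ => 1 + (r : ℂ) * w) (continuousAt_cpow_const h2)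
      (by fun_prop)

open MeasureTheory Set in
theorem integrableOn_exp_rpow_pow {γ : ℝ} (hγ : 0 < γ) (M : ℕ) :
    IntegrableOn (fun r : ℝ => Real.exp (-r) * r ^ (γ - 1) * (1 + r) ^ M) (Ioi 0) := by
  have h1 := Real.GammaIntegral_convergent hγ
  have h2 := Real.GammaIntegral_convergent (s := γ + M) (by positivity)
  refine ((h1.add h2).const_mul ((2 : ℝ) ^ (M - 1))).mono' ?_ ?_
  · refine ContinuousOn.aestronglyMeasurable (fun r hr => ?_) measurableSet_Ioi
    have hr : 0 < r := hr
    refine ContinuousAt.continuousWithinAt ?_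
    refine (ContinuousAt.mul (by fun_prop) ?_).mul (by fun_prop)
    exact Real.continuousAt_rpow_const _ _ (Or.inl hr.ne')
  · filter_upwards [ae_restrict_mem measurableSet_Ioi] with r hr
    have hr : 0 < r := hr
    rw [Real.norm_of_nonneg (by positivity)]
    have h3 := add_pow_le (zero_le_one (α := ℝ)) hr.le M
    calc Real.exp (-r) * r ^ (γ - 1) * (1 + r) ^ M
        ≤ Real.exp (-r) * r ^ (γ - 1) * (2 ^ (M - 1) * (1 ^ M + r ^ M)) := by gcongr
      _ = 2 ^ (M - 1) * (Real.exp (-r) * r ^ (γ - 1) +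
            Real.exp (-r) * (r ^ (γ - 1) * r ^ (M : ℝ))) := by
          rw [Real.rpow_natCast]; ring
      _ = _ := by
          rw [← Real.rpow_add hr]
          simp only [Pi.add_apply]
          congr 4
          ring_nf

open MeasureTheory Set in
/-- The integrands of `remInt` are dominated uniformly in compact sets of parameters, with a gain
of `‖w‖^N`. -/
theorem exists_remIntegrand_bound (N : ℕ) {α β B : ℝ} (hα : -(N : ℝ) < α) (hαβ : α ≤ β)
    (hB : 0 ≤ B) : ∃ D : ℝ → ℝ, IntegrableOn D (Ioi 0) ∧
      ∀ (a c w : ℂ) (r : ℝ), α ≤ a.re → a.re ≤ β → ‖c‖ ≤ B → 0 ≤ w.re → ‖w‖ ≤ 1 → 0 < r →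
        ‖remIntegrand N a c w r‖ ≤ ‖w‖ ^ N * D r := by
  obtain ⟨C, hC, M, h⟩ := exists_norm_taylorRem_le N B hB
  refine ⟨fun r => C * (Real.exp (-r) * r ^ ((α + N) - 1) * (1 + r) ^ M +
    Real.exp (-r) * r ^ ((β + N) - 1) * (1 + r) ^ M),
    ((integrableOn_exp_rpow_pow (by linarith) M).add
      (integrableOn_exp_rpow_pow (by linarith) M)).const_mul C, ?_⟩
  intro a c w r ha1 ha2 hc hw hw1 hr
  have hrw : 0 ≤ ((r : ℂ) * w).re := by simpa using mul_nonneg hr.le hw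
  have hnrw : ‖(r : ℂ) * w‖ = r * ‖w‖ := by
    rw [norm_mul, Complex.norm_real, Real.norm_of_nonneg hr.le]
  have h1 : ‖taylorRem N c (r * w)‖ ≤ C * (r * ‖w‖) ^ N * (1 + r) ^ M := by
    refine (h c hc _ hrw).trans ?_
    rw [hnrw]
    gcongr
    nlinarith
  have h2 : r ^ (a.re - 1) ≤ r ^ (α - 1) + r ^ (β - 1) := by
    rcases le_total 1 r with hr1 | hr1
    · have : r ^ (a.re - 1) ≤ r ^ (β - 1) := Real.rpow_le_rpow_of_exponent_le hr1 (by linarith)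
      have : 0 ≤ r ^ (α - 1) := by positivity
      linarith
    · have : r ^ (a.re - 1) ≤ r ^ (α - 1) :=
        Real.rpow_le_rpow_of_exponent_ge hr hr1 (by linarith)
      have : 0 ≤ r ^ (β - 1) := by positivity
      linarith
  rw [remIntegrand, norm_mul, norm_mul, Complex.norm_real, Real.norm_of_nonneg (Real.exp_pos _).le,
    Complex.norm_cpow_eq_rpow_re_of_pos hr]
  have e : ∀ γ : ℝ, r ^ (γ + N - 1) = r ^ (γ - 1) * r ^ N := fun γ => by
    rw [← Real.rpow_natCast, ← Real.rpow_add hr]; congr 1; ring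
  beta_reduce
  rw [e, e]
  calc Real.exp (-r) * r ^ ((a - 1).re) * ‖taylorRem N c (r * w)‖
      ≤ Real.exp (-r) * (r ^ (α - 1) + r ^ (β - 1)) * (C * (r * ‖w‖) ^ N * (1 + r) ^ M) := by
        gcongr
        simpa using h2
    _ = _ := by rw [mul_pow]; ring

open MeasureTheory Set in
theorem integrableOn_remIntegrand {N : ℕ} {a : ℂ} (c : ℂ) {w : ℂ} (ha : -(N : ℝ) < a.re)
    (hw : 0 ≤ w.re) (hw1 : ‖w‖ ≤ 1) : IntegrableOn (remIntegrand N a c w) (Ioi 0) := by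
  obtain ⟨D, hD, h⟩ := exists_remIntegrand_bound N ha le_rfl (norm_nonneg c)
  refine (hD.const_mul (‖w‖ ^ N)).mono'
    ((continuousOn_remIntegrand N a c hw).aestronglyMeasurable measurableSet_Ioi) ?_
  filter_upwards [ae_restrict_mem measurableSet_Ioi] with r hr
  exact h a c w r le_rfl le_rfl le_rfl hw hw1 hr

open MeasureTheory Set in
/-- `remInt` is bounded by `‖w‖^{Re a + N}`, uniformly for `(a,c)` in a bounded set. -/
theorem exists_norm_remInt_le (N : ℕ) {α β B : ℝ} (hα : -(N : ℝ) < α) (hαβ : α ≤ β)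
    (hB : 0 ≤ B) : ∃ K : ℝ, 0 ≤ K ∧
      ∀ (a c w : ℂ), α ≤ a.re → a.re ≤ β → ‖a‖ ≤ B → ‖c‖ ≤ B → 0 ≤ w.re → w ≠ 0 → ‖w‖ ≤ 1 →
        ‖remInt N a c w‖ ≤ K * ‖w‖ ^ (a.re + N) := by
  obtain ⟨D, hD, h⟩ := exists_remIntegrand_bound N hα hαβ hB
  refine ⟨Real.exp (Real.pi * B) * |∫ r in Ioi (0 : ℝ), D r|, by positivity, ?_⟩
  intro a c w ha1 ha2 haB hc hw hw0 hw1
  have hwp : 0 < ‖w‖ := norm_pos_iff.2 hw0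
  have h1 : ‖∫ r in Ioi (0 : ℝ), remIntegrand N a c w r‖ ≤ ‖w‖ ^ N * |∫ r in Ioi (0 : ℝ), D r| := by
    refine (norm_integral_le_of_norm_le (hD.const_mul (‖w‖ ^ N)) ?_).trans ?_
    · filter_upwards [ae_restrict_mem measurableSet_Ioi] with r hr
      exact h a c w r ha1 ha2 hc hw hw1 hr
    · rw [integral_const_mul]
      gcongr
      exact le_abs_self _
  have h2 : ‖w ^ a‖ ≤ ‖w‖ ^ a.re * Real.exp (Real.pi * B) := by
    rw [Complex.norm_cpow_of_ne_zero hw0, div_eq_mul_inv, ← Real.exp_neg]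
    gcongr
    calc -(w.arg * a.im) ≤ |w.arg * a.im| := neg_le_abs _
      _ = |w.arg| * |a.im| := abs_mul _ _
      _ ≤ _ := by
        gcongr
        · exact Complex.abs_arg_le_pi w
        · exact (Complex.abs_im_le_norm a).trans haB
  rw [remInt, norm_mul]
  calc _ ≤ (‖w‖ ^ a.re * Real.exp (Real.pi * B)) * (‖w‖ ^ N * |∫ r in Ioi (0 : ℝ), D r|) := by
        gcongr
    _ = _ := by
        rw [Real.rpow_add hwp, Real.rpow_natCast]; ring

open MeasureTheory Set in
theorem remInt_eq_add {N : ℕ} {a : ℂ} (c : ℂ) {w : ℂ} (ha : -(N : ℝ) < a.re)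
    (hw : 0 ≤ w.re) (hw1 : ‖w‖ ≤ 1) : remInt N a c w =
      w ^ a * (w ^ N * (binomCoeff c N * Complex.Gamma (a + N))) + remInt (N + 1) a c w := by
  have ha' : 0 < (a + N).re := by simp; linarith
  rw [remInt, remInt, ← mul_add]
  congr 1
  have h1 : IntegrableOn (fun r : ℝ => (w ^ N * binomCoeff c N) *
      ((Real.exp (-r) : ℂ) * (r : ℂ) ^ (a + N - 1))) (Ioi 0) :=
    (Complex.GammaIntegral_convergent ha').const_mul _
  have h2 : IntegrableOn (remIntegrand (N + 1) a c w) (Ioi 0) :=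
    integrableOn_remIntegrand c (by push_cast; linarith) hw hw1
  rw [Complex.Gamma_eq_integral ha', Complex.GammaIntegral, ← mul_assoc, ← integral_const_mul,
    ← integral_add h1 h2]
  refine setIntegral_congr_fun measurableSet_Ioi fun r hr => ?_
  have hr : 0 < r := hr
  have hr0 : (r : ℂ) ≠ 0 := by exact_mod_cast hr.ne'
  simp only [remIntegrand]
  rw [taylorRem_eq_add N, mul_pow, show a + N - 1 = (a - 1) + N by ring, Complex.cpow_add _ _ hr0,
    Complex.cpow_natCast]
  ring

open MeasureTheory Set in
/-- `remInt N s₂ (s₁-1) w` is jointly analytic in `(s₁,s₂)` for `Re s₂ > -N`. -/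
theorem analyticAt_remInt (N : ℕ) {w : ℂ} (hw : 0 ≤ w.re) (hws : w ∈ Complex.slitPlane)
    (hw1 : ‖w‖ ≤ 1) {s : ℂ × ℂ} (hs : -(N : ℝ) < s.2.re) :
    AnalyticAt ℂ (fun s : ℂ × ℂ => remInt N s.2 (s.1 - 1) w) s := by
  obtain ⟨α, hα, hα'⟩ := exists_between hs
  let U : Set (ℂ × ℂ) := {z | α < z.2.re} ∩ ({z | z.2.re < s.2.re + 1} ∩
    {z | ‖z.1 - 1‖ < ‖s.1 - 1‖ + 1})
  have hU : IsOpen U := by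
    refine IsOpen.inter (isOpen_lt (by fun_prop) (by fun_prop)) (IsOpen.inter
      (isOpen_lt (by fun_prop) (by fun_prop)) (isOpen_lt (by fun_prop) (by fun_prop)))
  have hsU : s ∈ U := ⟨hα', by simp, by simp⟩
  obtain ⟨D, hD, h⟩ := exists_remIntegrand_bound N (β := s.2.re + 1) (B := ‖s.1 - 1‖ + 1) hα
    (by linarith) (by positivity)
  have h1 : AnalyticOnNhd ℂ (fun z : ℂ × ℂ => ∫ r in Ioi (0 : ℝ),
      remIntegrand N z.2 (z.1 - 1) w r) U := by
    refine analyticAt_integral (bound := fun r => ‖w‖ ^ N * D r) hU (fun z hz =>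
      (continuousOn_remIntegrand N _ _ hw).aestronglyMeasurable measurableSet_Ioi)
      (hD.const_mul _) ?_ ?_
    · filter_upwards [ae_restrict_mem measurableSet_Ioi] with r hr z hz
      exact h _ _ w r hz.1.le hz.2.1.le hz.2.2.le hw hw1 hr
    · filter_upwards [ae_restrict_mem measurableSet_Ioi] with r hr z hz
      have hr : 0 < r := hr
      have hr1 : (r : ℂ) ∈ Complex.slitPlane := Or.inl (by simpa using hr)
      have hr2 : 1 + (r : ℂ) * w ∈ Complex.slitPlane :=
        one_add_mem_slitPlane (by simpa using mul_nonneg hr.le hw)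
      have hb : ∀ k, AnalyticAt ℂ (fun z : ℂ × ℂ => binomCoeff (z.1 - 1) k) z := fun k =>
        AnalyticAt.comp (g := fun c => binomCoeff c k) (analyticAt_binomCoeff k _)
          (analyticAt_fst.sub analyticAt_const)
      refine (analyticAt_const.mul (AnalyticAt.cpow analyticAt_const
        (analyticAt_snd.sub analyticAt_const) hr1)).mul (AnalyticAt.sub
          (AnalyticAt.cpow analyticAt_const (analyticAt_fst.sub analyticAt_const) hr2) ?_)
      exact Finset.analyticAt_fun_sum _ fun k _ => (hb k).mul analyticAt_const
  exact (AnalyticAt.cpow analyticAt_const analyticAt_snd hws).mul (h1 s hsU)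

/-! ### Meromorphic continuation of `F_±` -/

/-- `1 / (± 2πi l)`. -/
def invPoint (e : ℤˣ) (l : ℕ) : ℂ := (((e : ℤ) : ℂ) * (2 * Real.pi * Complex.I * l))⁻¹

theorem invPoint_eq (e : ℤˣ) (l : ℕ) :
    invPoint e l = (((-((e : ℤ) : ℝ)) * (2 * Real.pi * l)⁻¹ : ℝ) : ℂ) * Complex.I := by
  have hI := Complex.I_mul_I
  rcases Int.units_eq_one_or e with rfl | rfl <;>
  · simp only [invPoint]
    push_cast
    simp [Complex.inv_I]
    ring

theorem invPoint_re (e : ℤˣ) (l : ℕ) : (invPoint e l).re = 0 := by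
  rw [invPoint_eq]; simp

theorem units_int_cast_sq (e : ℤˣ) : |((e : ℤ) : ℝ)| = 1 := by
  rcases Int.units_eq_one_or e with rfl | rfl <;> simp

theorem norm_invPoint (e : ℤˣ) (l : ℕ) : ‖invPoint e l‖ = (2 * Real.pi * l)⁻¹ := by
  rw [invPoint_eq, norm_mul, Complex.norm_I, mul_one, Complex.norm_real, Real.norm_eq_abs, abs_mul,
    abs_neg, units_int_cast_sq, one_mul, abs_of_nonneg (by positivity)]

theorem invPoint_ne_zero (e : ℤˣ) {l : ℕ} (hl : 0 < l) : invPoint e l ≠ 0 := by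
  rw [← norm_pos_iff, norm_invPoint]
  have := Real.pi_pos
  positivity

theorem invPoint_mem_slitPlane (e : ℤˣ) {l : ℕ} (hl : 0 < l) :
    invPoint e l ∈ Complex.slitPlane := by
  right
  intro h
  exact invPoint_ne_zero e hl (Complex.ext (invPoint_re e l) h)

theorem norm_invPoint_le (e : ℤˣ) {l : ℕ} (hl : 0 < l) : ‖invPoint e l‖ ≤ (l : ℝ)⁻¹ := by
  rw [norm_invPoint]
  have h1 : (0 : ℝ) < l := by exact_mod_cast hl
  have h2 := Real.two_le_pi
  gcongr
  nlinarith

theorem norm_invPoint_le_one (e : ℤˣ) {l : ℕ} (hl : 0 < l) : ‖invPoint e l‖ ≤ 1 :=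
  (norm_invPoint_le e hl).trans (inv_le_one_of_one_le₀ (by exact_mod_cast hl))

theorem invPoint_cpow (e : ℤˣ) {l : ℕ} (hl : 0 < l) (a : ℂ) :
    invPoint e l ^ a = (l : ℂ) ^ (-a) * invPoint e 1 ^ a := by
  have h1 : (0 : ℝ) < l := by exact_mod_cast hl
  have h : invPoint e l = (((l : ℝ)⁻¹ : ℝ) : ℂ) * invPoint e 1 := by
    simp only [invPoint]; push_cast; simp only [mul_inv, inv_one]; ring
  rw [h, ofReal_mul_cpow (inv_pos.2 h1) (invPoint_ne_zero e one_pos)]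
  congr 1
  push_cast
  rw [Complex.cpow_neg, Complex.inv_cpow]
  rw [Complex.natCast_arg]
  exact Real.pi_pos.ne

variable {a : ℕ → ℂ} {κ : ℝ}

/-- Absolute convergence of the Dirichlet series of `a` in `Re s > (κ+1)/2`. -/
theorem lseriesSummable_of_growth
    (ha : ∀ ε : ℝ, 0 < ε → a =O[atTop] fun n : ℕ => (n : ℝ) ^ ((κ - 1) / 2 + ε))
    {s : ℂ} (hs : (κ + 1) / 2 < s.re) : LSeriesSummable a s := by
  refine LSeriesSummable_of_isBigO_rpow (x := ((κ + 1) / 2 + s.re) / 2) (by linarith) ?_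
  convert! ha ((s.re - (κ + 1) / 2) / 2) (by linarith) using 3
  ring

theorem summable_norm_coeff
    (ha : ∀ ε : ℝ, 0 < ε → a =O[atTop] fun n : ℕ => (n : ℝ) ^ ((κ - 1) / 2 + ε))
    {σ : ℝ} (hσ : (κ + 1) / 2 < σ) :
    Summable fun n : ℕ+ => ‖a n‖ * ((n : ℕ) : ℝ) ^ (-σ) := by
  have h := (lseriesSummable_of_growth ha (s := (σ : ℂ)) (by simpa using hσ)).norm
  have h2 := h.comp_injective PNat.coe_injective
  refine h2.congr fun n => ?_
  simp only [Function.comp_apply]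
  rw [LSeries.norm_term_eq, if_neg n.ne_zero, Complex.ofReal_re, Real.rpow_neg (by positivity),
    div_eq_mul_inv]

theorem summable_pnat_rpow_neg {σ : ℝ} (hσ : 1 < σ) :
    Summable fun n : ℕ+ => ((n : ℕ) : ℝ) ^ (-σ) :=
  (Real.summable_nat_rpow.2 (by linarith : -σ < -1)).comp_injective PNat.coe_injective

/-- The `N`-th remainder of the term of index `l = n k` in `Γ(s₂) F_±(s₁,s₂)`. -/
def termR (N : ℕ) (e : ℤˣ) (a : ℕ → ℂ) (s : ℂ × ℂ) (p : ℕ+ × ℕ+) : ℂ :=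
  ((p.1 : ℕ) : ℂ) ^ (s.1 + s.2 - 1) * a p.1 *
    remInt N s.2 (s.1 - 1) (invPoint e ((p.1 * p.2 : ℕ+) : ℕ))

/-- The region where the series of `N`-th remainders converges. -/
def regionR (κ : ℝ) (N : ℕ) : Set (ℂ × ℂ) :=
  {s | s.1.re < N + (1 - κ) / 2 ∧ 1 - (N : ℝ) < s.2.re}

theorem isOpen_regionR (κ : ℝ) (N : ℕ) : IsOpen (regionR κ N) :=
  IsOpen.inter (s := {s : ℂ × ℂ | s.1.re < N + (1 - κ) / 2})
    (t := {s : ℂ × ℂ | 1 - (N : ℝ) < s.2.re})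
    (isOpen_lt (by fun_prop) (by fun_prop)) (isOpen_lt (by fun_prop) (by fun_prop))

theorem regionR_mono (κ : ℝ) {N M : ℕ} (h : N ≤ M) : regionR κ N ⊆ regionR κ M := by
  rintro s ⟨h1, h2⟩
  have : (N : ℝ) ≤ M := by exact_mod_cast h
  exact ⟨by linarith, by linarith⟩

theorem exists_mem_regionR (κ : ℝ) (s : ℂ × ℂ) : ∃ N, s ∈ regionR κ N := by
  obtain ⟨N, hN⟩ := exists_nat_gt (max (s.1.re - (1 - κ) / 2) (1 - s.2.re))
  have h1 := (le_max_left _ _).trans_lt hN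
  have h2 := (le_max_right _ _).trans_lt hN
  exact ⟨N, by linarith, by linarith⟩

/-- Near each point of `regionR κ N` the terms `termR N` are dominated by a summable family. -/
theorem exists_termR_bound
    (ha : ∀ ε : ℝ, 0 < ε → a =O[atTop] fun n : ℕ => (n : ℝ) ^ ((κ - 1) / 2 + ε))
    (N : ℕ) (e : ℤˣ) {s : ℂ × ℂ} (hs : s ∈ regionR κ N) :
    ∃ U : Set (ℂ × ℂ), IsOpen U ∧ s ∈ U ∧ U ⊆ regionR κ N ∧ ∃ u : ℕ+ × ℕ+ → ℝ, Summable u ∧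
      ∀ p, ∀ z ∈ U, ‖termR N e a z p‖ ≤ u p := by
  obtain ⟨A₁, h1, h1'⟩ := exists_between hs.1
  obtain ⟨A₂, h2, h2'⟩ := exists_between hs.2
  let B := max (‖s.1 - 1‖ + 1) (‖s.2‖ + 1)
  have hB : 0 ≤ B := le_trans (by positivity) (le_max_left _ _)
  have hA₂B : A₂ ≤ B := by
    refine h2'.le.trans ((Complex.re_le_norm _).trans (le_trans (by linarith) (le_max_right _ _)))
  let U : Set (ℂ × ℂ) := ({z | z.1.re < A₁} ∩ {z | A₂ < z.2.re}) ∩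
    ({z | ‖z.1 - 1‖ < B} ∩ {z | ‖z.2‖ < B})
  have hU : IsOpen U := by
    refine (IsOpen.inter (isOpen_lt (by fun_prop) (by fun_prop))
      (isOpen_lt (by fun_prop) (by fun_prop))).inter
      (IsOpen.inter (isOpen_lt (by fun_prop) (by fun_prop)) (isOpen_lt (by fun_prop) (by fun_prop)))
  refine ⟨U, hU, ⟨⟨h1, h2'⟩, ?_, ?_⟩, ?_, ?_⟩
  · exact lt_of_lt_of_le (lt_add_one ‖s.1 - 1‖) (le_max_left _ _)
  · exact lt_of_lt_of_le (lt_add_one ‖s.2‖) (le_max_right _ _)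
  · exact fun z hz => ⟨lt_trans hz.1.1 h1', lt_trans h2 hz.1.2⟩
  obtain ⟨K, hK, hb⟩ := exists_norm_remInt_le N (α := A₂) (β := B) (B := B) (by linarith) hA₂B hB
  refine ⟨fun p => K * ((‖a p.1‖ * ((p.1 : ℕ) : ℝ) ^ (-(N + 1 - A₁))) *
    ((p.2 : ℕ) : ℝ) ^ (-(A₂ + N))), ?_, ?_⟩
  · refine Summable.mul_left K ?_
    refine Summable.mul_of_nonneg (f := fun n : ℕ+ => ‖a n‖ * ((n : ℕ) : ℝ) ^ (-(N + 1 - A₁)))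
      (g := fun n : ℕ+ => ((n : ℕ) : ℝ) ^ (-(A₂ + N)))
      (summable_norm_coeff ha (by linarith)) (summable_pnat_rpow_neg (by linarith))
      (fun n => by positivity) (fun n => by positivity)
  rintro ⟨n, k⟩ z hz
  have hl : 0 < ((n * k : ℕ+) : ℕ) := (n * k).pos
  have hn : (0 : ℝ) < ((n : ℕ) : ℝ) := by exact_mod_cast n.pos
  have hk : (0 : ℝ) < ((k : ℕ) : ℝ) := by exact_mod_cast k.pos
  have hn1 : (1 : ℝ) ≤ ((n : ℕ) : ℝ) := by exact_mod_cast n.pos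
  have hk1 : (1 : ℝ) ≤ ((k : ℕ) : ℝ) := by exact_mod_cast k.pos
  have hz2 : A₂ ≤ z.2.re := hz.1.2.le
  have hz1 : z.1.re ≤ A₁ := hz.1.1.le
  have h3 := hb z.2 (z.1 - 1) (invPoint e ((n * k : ℕ+) : ℕ)) hz2
    ((Complex.re_le_norm _).trans hz.2.2.le) hz.2.2.le hz.2.1.le (invPoint_re e _).ge
    (invPoint_ne_zero e hl) (norm_invPoint_le_one e hl)
  have h4 : ‖invPoint e ((n * k : ℕ+) : ℕ)‖ ^ (z.2.re + N) ≤
      ((n : ℕ) : ℝ) ^ (-(z.2.re + N)) * ((k : ℕ) : ℝ) ^ (-(A₂ + N)) := by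
    calc _ ≤ ((((n * k : ℕ+) : ℕ) : ℝ)⁻¹) ^ (z.2.re + N) := by
          refine Real.rpow_le_rpow (norm_nonneg _) (norm_invPoint_le e hl) (by linarith)
      _ = ((n : ℕ) : ℝ) ^ (-(z.2.re + N)) * ((k : ℕ) : ℝ) ^ (-(z.2.re + N)) := by
          rw [PNat.mul_coe, Nat.cast_mul, mul_inv, Real.mul_rpow (by positivity) (by positivity),
            Real.inv_rpow hn.le, Real.inv_rpow hk.le, Real.rpow_neg hn.le, Real.rpow_neg hk.le]
      _ ≤ _ := by
          gcongr
  have h5 : ‖((n : ℕ) : ℂ) ^ (z.1 + z.2 - 1)‖ = ((n : ℕ) : ℝ) ^ (z.1.re + z.2.re - 1) := by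
    rw [Complex.norm_natCast_cpow_of_pos n.pos]; simp
  simp only [termR]
  rw [norm_mul, norm_mul, h5]
  calc _ ≤ ((n : ℕ) : ℝ) ^ (z.1.re + z.2.re - 1) * ‖a n‖ *
        (K * (((n : ℕ) : ℝ) ^ (-(z.2.re + N)) * ((k : ℕ) : ℝ) ^ (-(A₂ + N)))) := by
        gcongr
        exact h3.trans (by gcongr)
    _ = K * ((‖a n‖ * (((n : ℕ) : ℝ) ^ (z.1.re + z.2.re - 1) * ((n : ℕ) : ℝ) ^ (-(z.2.re + N)))) *
        ((k : ℕ) : ℝ) ^ (-(A₂ + N))) := by ring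
    _ ≤ _ := by
        rw [← Real.rpow_add hn]
        gcongr
        linarith

theorem summable_termR
    (ha : ∀ ε : ℝ, 0 < ε → a =O[atTop] fun n : ℕ => (n : ℝ) ^ ((κ - 1) / 2 + ε))
    (N : ℕ) (e : ℤˣ) {s : ℂ × ℂ} (hs : s ∈ regionR κ N) : Summable (termR N e a s) := by
  obtain ⟨U, -, hsU, -, u, hu, hb⟩ := exists_termR_bound ha N e hs
  exact Summable.of_norm_bounded hu fun p => hb p s hsU

theorem analyticAt_tsum_termR
    (ha : ∀ ε : ℝ, 0 < ε → a =O[atTop] fun n : ℕ => (n : ℝ) ^ ((κ - 1) / 2 + ε))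
    (N : ℕ) (e : ℤˣ) {s : ℂ × ℂ} (hs : s ∈ regionR κ N) :
    AnalyticAt ℂ (fun z => ∑' p, termR N e a z p) s := by
  obtain ⟨U, hU, hsU, hUR, u, hu, hb⟩ := exists_termR_bound ha N e hs
  refine analyticOnNhd_tsum hU hu (fun p z hz => ?_) hb s hsU
  have h1 : ((p.1 : ℕ) : ℂ) ∈ Complex.slitPlane := Or.inl (by simp)
  refine ((AnalyticAt.cpow analyticAt_const
    ((analyticAt_fst.add analyticAt_snd).sub analyticAt_const) h1).mul analyticAt_const).mul ?_
  exact analyticAt_remInt N (invPoint_re e _).ge (invPoint_mem_slitPlane e (PNat.pos _))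
    (norm_invPoint_le_one e (PNat.pos _)) (by have := (hUR hz).2; linarith)

/-- The contribution of the `k`-th term of the asymptotic expansion of `Ψ` to `Γ(s₂) F_±(s₁,s₂)`. -/
def polarTerm (e : ℤˣ) (L : ℂ → ℂ) (k : ℕ) (s : ℂ × ℂ) : ℂ :=
  invPoint e 1 ^ s.2 * invPoint e 1 ^ k * binomCoeff (s.1 - 1) k * Complex.Gamma (s.2 + k) *
    L (1 - s.1 + k) * riemannZeta (s.2 + k)

theorem hasSum_coeff {L : ℂ → ℂ}
    (ha : ∀ ε : ℝ, 0 < ε → a =O[atTop] fun n : ℕ => (n : ℝ) ^ ((κ - 1) / 2 + ε))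
    (hL : ∀ s : ℂ, (κ + 1) / 2 < s.re → L s = LSeries a s) {s : ℂ} (hs : (κ + 1) / 2 < s.re) :
    HasSum (fun n : ℕ+ => a n * ((n : ℕ) : ℂ) ^ (-s)) (L s) := by
  have h := (lseriesSummable_of_growth ha hs).LSeriesHasSum
  rw [← hL s hs] at h
  have hi : ∀ x ∉ Set.range ((↑) : ℕ+ → ℕ), LSeries.term a s x = 0 := by
    intro x hx
    have : x = 0 := by
      by_contra h0
      exact hx ⟨⟨x, Nat.pos_of_ne_zero h0⟩, rfl⟩
    simp [this]
  have h2 := (PNat.coe_injective.hasSum_iff hi).2 h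
  convert! h2 using 2 with n
  rw [Function.comp_apply, LSeries.term_of_ne_zero n.ne_zero, Complex.cpow_neg, div_eq_mul_inv]

theorem isBigO_one_rpow (ε : ℝ) (hε : 0 < ε) :
    (fun _ : ℕ => (1 : ℂ)) =O[atTop] fun n : ℕ => (n : ℝ) ^ (((1 : ℝ) - 1) / 2 + ε) := by
  refine IsBigO.of_bound 1 ?_
  filter_upwards [eventually_ge_atTop 1] with n hn
  have : (1 : ℝ) ≤ n := by exact_mod_cast hn
  simp only [norm_one, one_mul]
  exact (Real.one_le_rpow this (by linarith)).trans (le_abs_self _)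

theorem hasSum_zeta {s : ℂ} (hs : 1 < s.re) :
    HasSum (fun n : ℕ+ => ((n : ℕ) : ℂ) ^ (-s)) (riemannZeta s) := by
  have h := hasSum_coeff (a := fun _ => 1) (κ := 1) (L := riemannZeta) (s := s) isBigO_one_rpow
    (fun s hs => (LSeries_one_eq_riemannZeta (by linarith)).symm) (by linarith)
  simpa using h

theorem termR_eq_add (a : ℕ → ℂ) (N : ℕ) (e : ℤˣ) {s : ℂ × ℂ} (hs : -(N : ℝ) < s.2.re)
    (p : ℕ+ × ℕ+) : termR N e a s p =
      (invPoint e 1 ^ s.2 * invPoint e 1 ^ N * binomCoeff (s.1 - 1) N * Complex.Gamma (s.2 + N)) *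
        ((a p.1 * ((p.1 : ℕ) : ℂ) ^ (-(1 - s.1 + N))) * ((p.2 : ℕ) : ℂ) ^ (-(s.2 + N))) +
      termR (N + 1) e a s p := by
  obtain ⟨n, k⟩ := p
  have hn0 : ((n : ℕ) : ℂ) ≠ 0 := by exact_mod_cast n.ne_zero
  have hk0 : ((k : ℕ) : ℂ) ≠ 0 := by exact_mod_cast k.ne_zero
  have hl : 0 < ((n * k : ℕ+) : ℕ) := (n * k).pos
  have hmul : ∀ c : ℂ, (((n * k : ℕ+) : ℕ) : ℂ) ^ c = ((n : ℕ) : ℂ) ^ c * ((k : ℕ) : ℂ) ^ c := by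
    intro c
    rw [PNat.mul_coe, Nat.cast_mul, Complex.natCast_mul_natCast_cpow]
  have h2 : invPoint e ((n * k : ℕ+) : ℕ) ^ N =
      ((n : ℕ) : ℂ) ^ (-(N : ℂ)) * ((k : ℕ) : ℂ) ^ (-(N : ℂ)) * invPoint e 1 ^ N := by
    rw [← Complex.cpow_natCast, invPoint_cpow e hl, Complex.cpow_natCast, hmul]
  simp only [termR]
  rw [remInt_eq_add _ hs (invPoint_re e _).ge (norm_invPoint_le_one e hl), mul_add, h2,
    invPoint_cpow e hl, hmul]
  have e1 : ((n : ℕ) : ℂ) ^ (-(1 - s.1 + N)) =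
      ((n : ℕ) : ℂ) ^ (s.1 + s.2 - 1) * ((n : ℕ) : ℂ) ^ (-s.2) * ((n : ℕ) : ℂ) ^ (-(N : ℂ)) := by
    rw [← Complex.cpow_add _ _ hn0, ← Complex.cpow_add _ _ hn0]; congr 1; ring
  have e2 : ((k : ℕ) : ℂ) ^ (-(s.2 + N)) =
      ((k : ℕ) : ℂ) ^ (-s.2) * ((k : ℕ) : ℂ) ^ (-(N : ℂ)) := by
    rw [← Complex.cpow_add _ _ hk0]; congr 1; ring
  rw [e1, e2]
  ring

theorem hasSum_mul_prod {ι ι' : Type*} {f : ι → ℂ} {g : ι' → ℂ} {x y : ℂ} (hf : HasSum f x)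
    (hg : HasSum g y) : HasSum (fun p : ι × ι' => f p.1 * g p.2) (x * y) :=
  hf.mul hg (summable_mul_of_summable_norm (f := f) (g := g) hf.summable.norm hg.summable.norm)

/-- Splitting off one more term of the asymptotic expansion. -/
theorem tsum_termR_eq_add {L : ℂ → ℂ}
    (ha : ∀ ε : ℝ, 0 < ε → a =O[atTop] fun n : ℕ => (n : ℝ) ^ ((κ - 1) / 2 + ε))
    (hL : ∀ s : ℂ, (κ + 1) / 2 < s.re → L s = LSeries a s)
    (N : ℕ) (e : ℤˣ) {s : ℂ × ℂ} (hs : s ∈ regionR κ N) :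
    ∑' p, termR N e a s p = polarTerm e L N s + ∑' p, termR (N + 1) e a s p := by
  have hA := hasSum_coeff (s := 1 - s.1 + N) ha hL (by have := hs.1; simp; linarith)
  have hZ := hasSum_zeta (s := s.2 + N) (by have := hs.2; simp; linarith)
  have hAZ := hasSum_mul_prod hA hZ
  have hR := (summable_termR ha (N + 1) e (regionR_mono κ (Nat.le_succ N) hs)).hasSum
  have hN : -(N : ℝ) < s.2.re := by have := hs.2; linarith
  have hfun := funext fun p => termR_eq_add a N e hN p
  have hpol : polarTerm e L N s = (invPoint e 1 ^ s.2 * invPoint e 1 ^ N * binomCoeff (s.1 - 1) N *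
      Complex.Gamma (s.2 + N)) * (L (1 - s.1 + N) * riemannZeta (s.2 + N)) := by
    rw [polarTerm]; ring
  rw [hpol, hfun]
  generalize invPoint e 1 ^ s.2 * invPoint e 1 ^ N * binomCoeff (s.1 - 1) N *
      Complex.Gamma (s.2 + N) = C
  exact ((hAZ.mul_left C).add hR).tsum_eq

theorem meromorphic_riemannZeta : Meromorphic riemannZeta := by
  intro s
  by_cases hs : s = 1
  · subst hs
    -- The exponent `2` makes `(s-1)^2 ζ(s)` continuous at `1` with its actual value `0` there.
    refine ⟨2, Complex.analyticAt_of_differentiable_on_punctured_nhds_of_continuousAt ?_ ?_⟩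
    · filter_upwards [self_mem_nhdsWithin] with z hz
      exact DifferentiableAt.fun_smul (by fun_prop) (differentiableAt_riemannZeta hz)
    · rw [continuousAt_iff_punctured_nhds]
      have h1 : Tendsto (fun z : ℂ => z - 1) (𝓝[≠] 1) (𝓝 0) := by
        have h : Continuous fun z : ℂ => z - 1 := by fun_prop
        simpa using (h.tendsto 1).mono_left nhdsWithin_le_nhds
      have h2 := h1.mul riemannZeta_residue_one
      simp only [sub_self, ne_eq, OfNat.ofNat_ne_zero, not_false_eq_true, zero_pow, zero_smul]
      rw [zero_mul] at h2
      refine h2.congr fun z => ?_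
      rw [smul_eq_mul]; ring
  · refine AnalyticAt.meromorphicAt ?_
    refine (DifferentiableOn.analyticAt (s := {1}ᶜ) (fun z hz =>
      (differentiableAt_riemannZeta hz).differentiableWithinAt)
      (isOpen_compl_singleton.mem_nhds hs))

theorem isOpenMap_snd_add (c : ℂ) : IsOpenMap fun s : ℂ × ℂ => s.2 + c :=
  (Homeomorph.addRight c).isOpenMap.comp isOpenMap_snd

theorem isOpenMap_const_sub_fst_add (b c : ℂ) : IsOpenMap fun s : ℂ × ℂ => b - s.1 + c :=
  (Homeomorph.addRight c).isOpenMap.comp ((Homeomorph.subLeft b).isOpenMap.comp isOpenMap_fst)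

theorem meromorphicAtTwo_polarTerm (e : ℤˣ) {L : ℂ → ℂ} (hL : Meromorphic L) (k : ℕ)
    (s : ℂ × ℂ) : MeromorphicAtTwo (polarTerm e L k) s := by
  have h1 : AnalyticAt ℂ (fun s : ℂ × ℂ =>
      invPoint e 1 ^ s.2 * invPoint e 1 ^ k * binomCoeff (s.1 - 1) k) s :=
    ((AnalyticAt.cpow analyticAt_const analyticAt_snd
      (invPoint_mem_slitPlane e one_pos)).mul analyticAt_const).mul
      (AnalyticAt.comp (g := fun c => binomCoeff c k) (analyticAt_binomCoeff k _)
          (analyticAt_fst.sub analyticAt_const))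
  have h2 : AnalyticAt ℂ (fun s : ℂ × ℂ => s.2 + (k : ℂ)) s := analyticAt_snd.add analyticAt_const
  have h3 : AnalyticAt ℂ (fun s : ℂ × ℂ => 1 - s.1 + (k : ℂ)) s :=
    (analyticAt_const.sub analyticAt_fst).add analyticAt_const
  exact ((h1.meromorphicAtTwo.mul
    ((Meromorphic.Gamma _).meromorphicAtTwo_comp h2 (isOpenMap_snd_add _))).mul
    ((hL _).meromorphicAtTwo_comp h3 (isOpenMap_const_sub_fst_add _ _))).mul
    ((meromorphic_riemannZeta _).meromorphicAtTwo_comp h2 (isOpenMap_snd_add _))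

/-- The continuation of `F_±` to `regionR κ N`. -/
def partF (e : ℤˣ) (a : ℕ → ℂ) (L : ℂ → ℂ) (N : ℕ) (s : ℂ × ℂ) : ℂ :=
  (Complex.Gamma s.2)⁻¹ *
    (∑ k ∈ Finset.range N, polarTerm e L k s + ∑' p, termR N e a s p)

theorem partF_eq_of_le {L : ℂ → ℂ}
    (ha : ∀ ε : ℝ, 0 < ε → a =O[atTop] fun n : ℕ => (n : ℝ) ^ ((κ - 1) / 2 + ε))
    (hL : ∀ s : ℂ, (κ + 1) / 2 < s.re → L s = LSeries a s)
    {N M : ℕ} (h : N ≤ M) (e : ℤˣ) {s : ℂ × ℂ} (hs : s ∈ regionR κ N) :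
    partF e a L N s = partF e a L M s := by
  induction M, h using Nat.le_induction with
  | base => rfl
  | succ M hM ih =>
    rw [ih, partF, partF, tsum_termR_eq_add ha hL M e (regionR_mono κ hM hs),
      Finset.sum_range_succ]
    ring

/-- The function `F_±` on `ℂ²`, with arbitrary values at its singularities. -/
def rawF (κ : ℝ) (e : ℤˣ) (a : ℕ → ℂ) (L : ℂ → ℂ) (s : ℂ × ℂ) : ℂ :=
  partF e a L (exists_mem_regionR κ s).choose s

theorem rawF_eq {L : ℂ → ℂ}
    (ha : ∀ ε : ℝ, 0 < ε → a =O[atTop] fun n : ℕ => (n : ℝ) ^ ((κ - 1) / 2 + ε))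
    (hL : ∀ s : ℂ, (κ + 1) / 2 < s.re → L s = LSeries a s)
    (N : ℕ) (e : ℤˣ) {s : ℂ × ℂ} (hs : s ∈ regionR κ N) :
    rawF κ e a L s = partF e a L N s := by
  have h := (exists_mem_regionR κ s).choose_spec
  rcases le_total N (exists_mem_regionR κ s).choose with hN | hN
  · exact (partF_eq_of_le ha hL hN e hs).symm
  · exact partF_eq_of_le ha hL hN e h

theorem analyticAt_inv_Gamma_snd (s : ℂ × ℂ) :
    AnalyticAt ℂ (fun s : ℂ × ℂ => (Complex.Gamma s.2)⁻¹) s :=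
  AnalyticAt.comp (g := fun z => (Complex.Gamma z)⁻¹)
    (Complex.differentiable_one_div_Gamma.analyticAt _) analyticAt_snd

theorem meromorphicAtTwo_rawF {L : ℂ → ℂ}
    (ha : ∀ ε : ℝ, 0 < ε → a =O[atTop] fun n : ℕ => (n : ℝ) ^ ((κ - 1) / 2 + ε))
    (hLm : Meromorphic L) (hL : ∀ s : ℂ, (κ + 1) / 2 < s.re → L s = LSeries a s)
    (e : ℤˣ) (s : ℂ × ℂ) : MeromorphicAtTwo (rawF κ e a L) s := by
  obtain ⟨N, hN⟩ := exists_mem_regionR κ s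
  have h1 : MeromorphicAtTwo (partF e a L N) s :=
    (analyticAt_inv_Gamma_snd s).meromorphicAtTwo.mul
      ((MeromorphicAtTwo.sum _ fun k _ => meromorphicAtTwo_polarTerm e hLm k s).add
        (analyticAt_tsum_termR ha N e hN).meromorphicAtTwo)
  refine h1.congr (genericAt_le_nhds s ?_)
  filter_upwards [(isOpen_regionR κ N).mem_nhds hN] with z hz
  exact (rawF_eq ha hL N e hz).symm

theorem rawF_eq_tsum {L : ℂ → ℂ}
    (ha : ∀ ε : ℝ, 0 < ε → a =O[atTop] fun n : ℕ => (n : ℝ) ^ ((κ - 1) / 2 + ε))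
    (hL : ∀ s : ℂ, (κ + 1) / 2 < s.re → L s = LSeries a s)
    (e : ℤˣ) {s : ℂ × ℂ} (hs : s ∈ regionR κ 0) :
    rawF κ e a L s = (Complex.Gamma s.2)⁻¹ * ∑' p, termR 0 e a s p := by
  rw [rawF_eq ha hL 0 e hs, partF]; simp

theorem analyticAt_rawF {L : ℂ → ℂ}
    (ha : ∀ ε : ℝ, 0 < ε → a =O[atTop] fun n : ℕ => (n : ℝ) ^ ((κ - 1) / 2 + ε))
    (hL : ∀ s : ℂ, (κ + 1) / 2 < s.re → L s = LSeries a s)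
    (e : ℤˣ) {s : ℂ × ℂ} (hs : s ∈ regionR κ 0) : AnalyticAt ℂ (rawF κ e a L) s := by
  refine ((analyticAt_inv_Gamma_snd s).mul (analyticAt_tsum_termR ha 0 e hs)).congr ?_
  filter_upwards [(isOpen_regionR κ 0).mem_nhds hs] with z hz
  exact (rawF_eq_tsum ha hL e hz).symm

theorem termF_eq_sum (e : ℤˣ) (a : ℕ → ℂ) (s₁ s₂ : ℂ) (l : ℕ+) :
    termF e a s₁ s₂ l = ∑ p : Nat.divisorsAntidiagonal l, (Complex.Gamma s₂)⁻¹ *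
      termR 0 e a (s₁, s₂) (sigmaAntidiagonalEquivProd ⟨l, p⟩) := by
  have hx : ((e : ℤ) : ℂ) * (2 * Real.pi * Complex.I * (l : ℕ)) ≠ 0 := by
    have := invPoint_ne_zero e l.pos
    rw [invPoint] at this
    exact fun h => this (by rw [h, inv_zero])
  let G : ℕ × ℕ → ℂ := fun q => (q.1 : ℂ) ^ (s₁ + s₂ - 1) * a q.1 *
    ((Complex.Gamma s₂)⁻¹ * remInt 0 s₂ (s₁ - 1) (invPoint e l))
  have h2 : ∀ p : Nat.divisorsAntidiagonal l, (Complex.Gamma s₂)⁻¹ *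
      termR 0 e a (s₁, s₂) (sigmaAntidiagonalEquivProd ⟨l, p⟩) = G p := by
    intro p
    have h3 : (((divisorsAntidiagonalFactors l p).1 * (divisorsAntidiagonalFactors l p).2 : ℕ+) : ℕ)
        = l := divisorsAntidiagonalFactors_eq p
    have h4 : sigmaAntidiagonalEquivProd ⟨l, p⟩ = divisorsAntidiagonalFactors l p := rfl
    have h5 : ((divisorsAntidiagonalFactors l p).1 : ℕ) = (p : ℕ × ℕ).1 := rfl
    simp only [termR, h4, h3, h5, G]
    ring
  rw [Finset.sum_congr rfl fun p _ => h2 p, Finset.sum_coe_sort (Nat.divisorsAntidiagonal l) G,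
    ← Finset.sum_mul,
    Nat.sum_divisorsAntidiagonal (f := fun n _ => (n : ℂ) ^ (s₁ + s₂ - 1) * a n), termF,
    confluentPsi_eq_remInt _ _ hx, twistedDivisorSum, show s₁ + s₂ - s₂ - 1 = s₁ - 1 by ring,
    invPoint]

theorem hasSum_termF {L : ℂ → ℂ}
    (ha : ∀ ε : ℝ, 0 < ε → a =O[atTop] fun n : ℕ => (n : ℝ) ^ ((κ - 1) / 2 + ε))
    (hL : ∀ s : ℂ, (κ + 1) / 2 < s.re → L s = LSeries a s)
    (e : ℤˣ) {s₁ s₂ : ℂ} (hs : (s₁, s₂) ∈ regionR κ 0) :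
    HasSum (termF e a s₁ s₂) (rawF κ e a L (s₁, s₂)) := by
  have h := ((summable_termR ha 0 e hs).hasSum.mul_left (Complex.Gamma s₂)⁻¹)
  rw [rawF_eq_tsum ha hL e hs]
  have h1 := sigmaAntidiagonalEquivProd.hasSum_iff.2 h
  -- The pairs `(n,k)` are grouped by their product `l`.
  refine (h1.sigma (g := termF e a s₁ s₂) fun l => ?_)
  rw [termF_eq_sum]
  exact hasSum_fintype _

/-! ### The Laplace transform of `y^{α-1} (1+y)^c` up to the imaginary axis -/

/-- `∫_0^∞ e^{-xy} y^{α-1} (1+y)^c dy`. -/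
def laplaceInt (α c x : ℂ) : ℂ :=
  ∫ y in Set.Ioi (0 : ℝ), Complex.exp (-x * y) * (y : ℂ) ^ (α - 1) * (y + 1 : ℂ) ^ c

open MeasureTheory Set in
theorem laplaceInt_eq_remInt_of_pos {α : ℂ} (hα : 0 < α.re) (c : ℂ) {t : ℝ} (ht : 0 < t) :
    laplaceInt α c t = remInt 0 α c (t : ℂ)⁻¹ := by
  have hΓ : (Complex.Gamma α)⁻¹ ≠ 0 := inv_ne_zero (Complex.Gamma_ne_zero_of_re_pos hα)
  have h := confluentPsi_eq_remInt α (c + α + 1) (x := t) (by exact_mod_cast ht.ne')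
  have harg : Complex.arg (t : ℂ) = 0 := Complex.arg_ofReal_of_nonneg ht.le
  rw [confluentPsi, confluentPsiRay, harg, show c + α + 1 - α - 1 = c by ring] at h
  have h2 := mul_left_cancel₀ hΓ h
  rw [← h2, laplaceInt]
  simp

open MeasureTheory Set in
theorem integrableOn_rpow_mul_one_add_rpow {p q : ℝ} (hp : -1 < p) (hq : q ≤ 0)
    (hpq : p + q < -1) : IntegrableOn (fun y : ℝ => y ^ p * (1 + y) ^ q) (Ioi 0) := by
  have hm : ∀ s ⊆ Ioi (0 : ℝ), MeasurableSet s →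
      AEStronglyMeasurable (fun y : ℝ => y ^ p * (1 + y) ^ q) (volume.restrict s) := by
    intro s hs hms
    refine ContinuousOn.aestronglyMeasurable (fun y hy => ?_) hms
    have hy : 0 < y := hs hy
    refine ContinuousAt.continuousWithinAt ?_
    refine (Real.continuousAt_rpow_const _ _ (Or.inl hy.ne')).mul ?_
    exact ContinuousAt.rpow_const (by fun_prop) (Or.inl (by positivity))
  rw [← Ioc_union_Ioi_eq_Ioi zero_le_one]
  refine IntegrableOn.union ?_ ?_
  · have h1 := (intervalIntegrable_iff_integrableOn_Ioc_of_le zero_le_one).1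
      (intervalIntegral.intervalIntegrable_rpow' hp (a := 0) (b := 1))
    refine h1.mono' (hm _ Ioc_subset_Ioi_self measurableSet_Ioc) ?_
    filter_upwards [ae_restrict_mem measurableSet_Ioc] with y hy
    have hy0 : 0 < y := hy.1
    rw [Real.norm_of_nonneg (by positivity)]
    exact mul_le_of_le_one_right (by positivity)
      (Real.rpow_le_one_of_one_le_of_nonpos (by linarith) hq)
  · refine (integrableOn_Ioi_rpow_of_lt hpq one_pos).mono'
      (hm _ (Ioi_subset_Ioi zero_le_one) measurableSet_Ioi) ?_
    filter_upwards [ae_restrict_mem measurableSet_Ioi] with y hy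
    have hy1 : 1 < y := hy
    have hy0 : 0 < y := by linarith
    rw [Real.norm_of_nonneg (by positivity), Real.rpow_add hy0]
    exact mul_le_mul_of_nonneg_left (Real.rpow_le_rpow_of_nonpos hy0 (by linarith) hq)
      (by positivity)

open MeasureTheory Set in
/-- The rotation of the path of integration in `Ψ`: on the whole closed right half-plane the
integral along the positive axis equals the one along the ray on which `xy` is positive. Both are
holomorphic in `x`, agree for `x > 0`, and are continuous up to the imaginary axis. -/
theorem laplaceInt_eq_remInt {α c : ℂ} (hα : 0 < α.re) (hc : c.re ≤ 0) (hαc : α.re + c.re < 0)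
    {x : ℂ} (hx : 0 ≤ x.re) (hx0 : x ≠ 0) : laplaceInt α c x = remInt 0 α c x⁻¹ := by
  have hslit : ∀ y : ℝ, 0 < y → (y : ℂ) ∈ Complex.slitPlane :=
    fun y hy => Or.inl (by simpa using hy)
  have hslit' : ∀ y : ℝ, 0 < y → (y + 1 : ℂ) ∈ Complex.slitPlane := fun y hy =>
    Or.inl (by simp; linarith)
  have hmeasG : ∀ x : ℂ, AEStronglyMeasurable (fun y : ℝ => Complex.exp (-x * y) *
      (y : ℂ) ^ (α - 1) * (y + 1 : ℂ) ^ c) (volume.restrict (Ioi 0)) := by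
    intro x
    refine ContinuousOn.aestronglyMeasurable (fun y hy => ?_) measurableSet_Ioi
    refine ContinuousAt.continuousWithinAt ?_
    refine (ContinuousAt.mul (by fun_prop) ?_).mul ?_
    · exact (continuousAt_cpow_const (hslit y hy)).comp Complex.continuous_ofReal.continuousAt
    · exact ContinuousAt.comp (f := fun r : ℝ => (r + 1 : ℂ))
        (continuousAt_cpow_const (hslit' y hy)) (by fun_prop)
  have hbG : ∀ᵐ y : ℝ ∂(volume.restrict (Ioi (0 : ℝ))), ∀ x ∈ {x : ℂ | 0 ≤ x.re},
      ‖Complex.exp (-x * y) * (y : ℂ) ^ (α - 1) * (y + 1 : ℂ) ^ c‖ ≤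
        y ^ (α.re - 1) * (1 + y) ^ c.re := by
    filter_upwards [ae_restrict_mem measurableSet_Ioi] with y hy x hx
    have hy : 0 < y := hy
    have hx : 0 ≤ x.re := hx
    rw [norm_mul, norm_mul, Complex.norm_exp, Complex.norm_cpow_eq_rpow_re_of_pos hy,
      show (y + 1 : ℂ) = ((1 + y : ℝ) : ℂ) by push_cast; ring,
      Complex.norm_cpow_eq_rpow_re_of_pos (by linarith)]
    simp only [Complex.sub_re, Complex.one_re]
    rw [mul_assoc]
    refine mul_le_of_le_one_left (by positivity) (Real.exp_le_one_iff.2 ?_)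
    simp only [Complex.mul_re, Complex.neg_re, Complex.ofReal_re, Complex.ofReal_im, mul_zero,
      sub_zero]
    nlinarith
  have hiG := integrableOn_rpow_mul_one_add_rpow (p := α.re - 1) (q := c.re) (by linarith) hc
    (by linarith)
  have hGc : ContinuousOn (laplaceInt α c) {x | 0 ≤ x.re} := by
    refine continuousOn_of_dominated (fun x _ => hmeasG x) (fun x hx => ?_) hiG ?_
    · filter_upwards [hbG] with y hy using hy x hx
    · exact Eventually.of_forall fun y => by fun_prop
  have hGd : ∀ x ∈ {x : ℂ | 0 < x.re}, DifferentiableAt ℂ (laplaceInt α c) x := by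
    intro x hx
    refine differentiableAt_integral (U := {x | 0 < x.re})
      ((isOpen_lt continuous_const Complex.continuous_re).mem_nhds hx) (fun x _ => hmeasG x)
      hiG ?_ ?_
    · filter_upwards [hbG] with y hy x hx using hy x hx.le
    · exact Eventually.of_forall fun y x _ => by fun_prop
  let J : ℂ → ℂ := fun w => ∫ r in Ioi (0 : ℝ), remIntegrand 0 α c w r
  have hbJ : ∀ᵐ r : ℝ ∂(volume.restrict (Ioi (0 : ℝ))), ∀ w ∈ {w : ℂ | 0 ≤ w.re},
      ‖remIntegrand 0 α c w r‖ ≤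
        Real.exp (-r) * r ^ (α.re - 1) * Real.exp (Real.pi * ‖c‖) := by
    filter_upwards [ae_restrict_mem measurableSet_Ioi] with r hr w hw
    have hr : 0 < r := hr
    have hrw : 0 ≤ ((r : ℂ) * w).re := by simpa using mul_nonneg hr.le hw
    have h1 : 1 ≤ ‖1 + (r : ℂ) * w‖ := by
      have := Complex.re_le_norm (1 + (r : ℂ) * w)
      simp only [Complex.add_re, Complex.one_re] at this; linarith
    rw [remIntegrand, norm_mul, norm_mul, Complex.norm_real,
      Real.norm_of_nonneg (Real.exp_pos _).le, Complex.norm_cpow_eq_rpow_re_of_pos hr]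
    simp only [Complex.sub_re, Complex.one_re]
    gcongr
    simp only [taylorRem, Finset.range_zero, Finset.sum_empty, sub_zero]
    refine (norm_one_add_cpow_le hrw c).trans ?_
    exact mul_le_of_le_one_left (by positivity) (Real.rpow_le_one_of_one_le_of_nonpos h1 hc)
  have hiJ : IntegrableOn (fun r : ℝ => Real.exp (-r) * r ^ (α.re - 1) *
      Real.exp (Real.pi * ‖c‖)) (Ioi 0) := (Real.GammaIntegral_convergent hα).mul_const _
  have hmeasJ : ∀ w ∈ {w : ℂ | 0 ≤ w.re}, AEStronglyMeasurable (remIntegrand 0 α c w)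
      (volume.restrict (Ioi 0)) := fun w hw =>
    (continuousOn_remIntegrand 0 α c hw).aestronglyMeasurable measurableSet_Ioi
  have hdiffJ : ∀ r : ℝ, 0 < r → ∀ w ∈ {w : ℂ | 0 ≤ w.re},
      DifferentiableAt ℂ (fun w => remIntegrand 0 α c w r) w := by
    intro r hr w hw
    have hrw : 0 ≤ ((r : ℂ) * w).re := by simpa using mul_nonneg hr.le hw
    simp only [remIntegrand, taylorRem, Finset.range_zero, Finset.sum_empty, sub_zero]
    refine DifferentiableAt.mul (by fun_prop) ?_
    exact DifferentiableAt.cpow_const (by fun_prop) (one_add_mem_slitPlane hrw)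
  have hJc : ContinuousOn J {w | 0 ≤ w.re} := by
    refine continuousOn_of_dominated hmeasJ (fun x hx => ?_) hiJ ?_
    · filter_upwards [hbJ] with y hy using hy x hx
    · filter_upwards [ae_restrict_mem measurableSet_Ioi] with r hr w hw
      exact (hdiffJ r hr w hw).continuousAt.continuousWithinAt
  have hJd : ∀ w ∈ {w : ℂ | 0 < w.re}, DifferentiableAt ℂ J w := by
    intro w hw
    refine differentiableAt_integral (U := {x | 0 < x.re})
      ((isOpen_lt continuous_const Complex.continuous_re).mem_nhds hw)
      (fun x hx => hmeasJ x (show 0 < x.re from hx).le) hiJ ?_ ?_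
    · filter_upwards [hbJ] with y hy x hx using hy x hx.le
    · filter_upwards [ae_restrict_mem measurableSet_Ioi] with r hr w hw
      exact hdiffJ r hr w hw.le
  have hinv : ∀ x : ℂ, 0 ≤ x.re → 0 ≤ (x⁻¹).re := fun x hx => by
    rw [Complex.inv_re]; exact div_nonneg hx (Complex.normSq_nonneg _)
  have hinv' : ∀ x : ℂ, 0 < x.re → 0 < (x⁻¹).re := fun x hx => by
    rw [Complex.inv_re]
    refine div_pos hx (Complex.normSq_pos.2 ?_)
    rintro rfl; simp at hx
  have hne : ∀ x : ℂ, 0 < x.re → x ≠ 0 := by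
    rintro x hx rfl; simp at hx
  have hinvs : ∀ x : ℂ, 0 ≤ x.re → x ≠ 0 → x⁻¹ ∈ Complex.slitPlane := by
    intro x hx hx0
    rw [Complex.mem_slitPlane_iff_not_le_zero, Complex.le_def]
    rintro ⟨h1, h2⟩
    have h3 : (x⁻¹).re = 0 := le_antisymm h1 (hinv x hx)
    exact inv_ne_zero hx0 (Complex.ext h3 h2)
  have hEq : EqOn (laplaceInt α c) (fun x => remInt 0 α c x⁻¹) {x : ℂ | 0 < x.re} := by
    have hopen : IsOpen {x : ℂ | 0 < x.re} := isOpen_lt continuous_const Complex.continuous_re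
    refine AnalyticOnNhd.eqOn_of_preconnected_of_frequently_eq (z₀ := 1)
      (DifferentiableOn.analyticOnNhd (fun x hx => (hGd x hx).differentiableWithinAt) hopen)
      (DifferentiableOn.analyticOnNhd (fun x hx => ?_) hopen)
      (convex_halfSpace_re_gt 0).isPreconnected (by simp) ?_
    · have h1 : DifferentiableAt ℂ (fun x : ℂ => x⁻¹) x := differentiableAt_inv (hne x hx)
      exact ((h1.cpow_const (hinvs x (le_of_lt hx) (hne x hx))).mul
        ((hJd x⁻¹ (hinv' x hx)).comp x h1)).differentiableWithinAt
    · have ht : Tendsto (fun n : ℕ => ((1 + 1 / ((n : ℝ) + 1) : ℝ) : ℂ)) atTop (𝓝[≠] 1) := by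
        refine tendsto_nhdsWithin_iff.2 ⟨?_, Eventually.of_forall fun n => ?_⟩
        · have := (Complex.continuous_ofReal.tendsto _).comp
            ((tendsto_const_nhds (x := (1 : ℝ))).add
              (tendsto_one_div_add_atTop_nhds_zero_nat (𝕜 := ℝ)))
          simpa [Function.comp_def] using this
        · simp only [mem_compl_iff, mem_singleton_iff]
          intro h
          have h2 : (1 + 1 / ((n : ℝ) + 1) : ℝ) = 1 := by exact_mod_cast h
          have h3 : 0 < 1 / ((n : ℝ) + 1) := by positivity
          linarith
      refine ht.frequently (Frequently.of_forall fun n => ?_)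
      exact laplaceInt_eq_remInt_of_pos hα c (by positivity)
  have hcl := hEq.of_subset_closure (t := {x : ℂ | 0 ≤ x.re} ∩ {0}ᶜ)
    (hGc.mono inter_subset_left) ?_ (fun x hx => ⟨(show 0 < x.re from hx).le, hne x hx⟩)
    (by rw [Complex.closure_setOfPred_lt_re]; exact inter_subset_left)
  · exact hcl ⟨hx, hx0⟩
  · have h1 : ContinuousOn (fun x : ℂ => x⁻¹) ({x : ℂ | 0 ≤ x.re} ∩ {0}ᶜ) :=
      continuousOn_inv₀.mono inter_subset_right
    refine ContinuousOn.mul ?_ (hJc.comp h1 fun x hx => hinv x hx.1)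
    intro x hx
    exact (ContinuousAt.comp (f := fun x : ℂ => x⁻¹)
      (continuousAt_cpow_const (hinvs x hx.1 hx.2)) (continuousAt_inv₀ hx.2)).continuousWithinAt

open MeasureTheory Set in
/-- Euler's beta integral over `(0, ∞)`. -/
theorem laplaceInt_zero {α c : ℂ} (hα : 0 < α.re) (hαc : α.re + c.re < 0) :
    laplaceInt α c 0 =
      Complex.Gamma α * Complex.Gamma (-α - c) / Complex.Gamma (-c) := by
  have hv : 0 < (-α - c).re := by simp; linarith
  have h := Complex.betaIntegral_eq_Gamma_mul_div α (-α - c) hα hv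
  rw [show α + (-α - c) = -c by ring] at h
  rw [← h, Complex.betaIntegral, intervalIntegral.integral_of_le zero_le_one,
    integral_Ioc_eq_integral_Ioo]
  have himg : (fun x : ℝ => x / (1 - x)) '' Ioo 0 1 = Ioi 0 := by
    ext y
    constructor
    · rintro ⟨x, ⟨h0, h1⟩, rfl⟩
      exact div_pos h0 (by linarith)
    · intro hy
      have hy : 0 < y := hy
      refine ⟨y / (1 + y), ⟨by positivity, by rw [div_lt_one (by positivity)]; linarith⟩, ?_⟩
      have : 1 + y ≠ 0 := by positivity
      field_simp
      ring
  have hder : ∀ x ∈ Ioo (0 : ℝ) 1,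
      HasDerivWithinAt (fun x : ℝ => x / (1 - x)) (1 / (1 - x) ^ 2) (Ioo 0 1) x := by
    intro x hx
    have hx1 : 1 - x ≠ 0 := by linarith [hx.2]
    have := ((hasDerivAt_id x).div ((hasDerivAt_id x).const_sub 1) hx1).hasDerivWithinAt
      (s := Ioo 0 1)
    convert! this using 1
    simp
  have hinj : InjOn (fun x : ℝ => x / (1 - x)) (Ioo 0 1) := by
    intro x hx y hy hxy
    have hx1 : 1 - x ≠ 0 := by linarith [hx.2]
    have hy1 : 1 - y ≠ 0 := by linarith [hy.2]
    simp only at hxy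
    rw [div_eq_div_iff hx1 hy1] at hxy
    linarith
  rw [laplaceInt, ← himg, integral_image_eq_integral_abs_deriv_smul measurableSet_Ioo hder hinj]
  refine setIntegral_congr_fun measurableSet_Ioo fun x hx => ?_
  have hx0 : 0 < x := hx.1
  have hx1 : 0 < 1 - x := by linarith [hx.2]
  have hx1' : ((1 - x : ℝ) : ℂ) ≠ 0 := by exact_mod_cast hx1.ne'
  have e1 : ((x / (1 - x) : ℝ) : ℂ) ^ (α - 1) =
      (x : ℂ) ^ (α - 1) * ((1 - x : ℝ) : ℂ) ^ (-(α - 1)) := by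
    rw [div_eq_mul_inv, Complex.ofReal_mul, Complex.mul_cpow_ofReal_nonneg hx0.le (by positivity),
      Complex.cpow_neg, Complex.ofReal_inv, Complex.inv_cpow]
    rw [Complex.arg_ofReal_of_nonneg hx1.le]; exact Real.pi_pos.ne
  have e2 : (((x / (1 - x) : ℝ) : ℂ) + 1) ^ c = ((1 - x : ℝ) : ℂ) ^ (-c) := by
    have : ((x / (1 - x) : ℝ) : ℂ) + 1 = ((1 - x : ℝ) : ℂ)⁻¹ := by
      rw [← Complex.ofReal_one, ← Complex.ofReal_add, ← Complex.ofReal_inv]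
      congr 1; field_simp; ring
    rw [this, Complex.inv_cpow, Complex.cpow_neg]
    rw [Complex.arg_ofReal_of_nonneg hx1.le]; exact Real.pi_pos.ne
  have e3 : ((|1 / (1 - x) ^ 2| : ℝ) : ℂ) = ((1 - x : ℝ) : ℂ) ^ (-2 : ℂ) := by
    rw [abs_of_pos (by positivity), Complex.cpow_neg]
    push_cast
    rw [one_div, ← Complex.cpow_natCast]
    norm_num
  simp only [neg_zero, zero_mul, Complex.exp_zero, one_mul]
  rw [Complex.real_smul, e1, e2, e3, show (1 - (x : ℂ)) = ((1 - x : ℝ) : ℂ) by push_cast; ring,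
    show -α - c - 1 = -2 + (-(α - 1)) + -c by ring, Complex.cpow_add _ _ hx1',
    Complex.cpow_add _ _ hx1']
  ring

/-! ### Poisson summation in the inner sum -/

theorem hasSum_int_of_pnat {f : ℤ → ℂ} {x y : ℂ} (hp : HasSum (fun n : ℕ+ => f (n : ℕ)) x)
    (hm : HasSum (fun n : ℕ+ => f (-(n : ℕ))) y) : HasSum f (f 0 + x + y) := by
  have h1 : HasSum (fun n : ℕ => f ((n + 1 : ℕ) : ℤ)) x :=
    (Equiv.pnatEquivNat.symm.hasSum_iff (f := fun n : ℕ+ => f (n : ℕ))).2 hp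
  have h2 : HasSum (fun n : ℕ => f (-((n + 1 : ℕ) : ℤ))) y :=
    (Equiv.pnatEquivNat.symm.hasSum_iff (f := fun n : ℕ+ => f (-(n : ℕ)))).2 hm
  have h3 : HasSum (fun n : ℕ => f (n : ℤ)) (x + f 0) := by
    have := (hasSum_nat_add_iff (f := fun n : ℕ => f (n : ℤ)) 1).1 h1
    simpa using this
  have h4 := HasSum.of_nat_of_neg_add_one h3 (by simpa using h2)
  rwa [add_comm x] at h4

/-- `u^{-s₁} (n+u)^{-s₂}` for `u > 0`, extended by `0`. -/
def summand (s₁ s₂ : ℂ) (n : ℕ) (u : ℝ) : ℂ :=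
  ((max u 0 : ℝ) : ℂ) ^ (-s₁) * ((n + max u 0 : ℝ) : ℂ) ^ (-s₂)

theorem summand_of_nonpos {s₁ : ℂ} (hs₁ : s₁.re < 0) (s₂ : ℂ) (n : ℕ) {u : ℝ} (hu : u ≤ 0) :
    summand s₁ s₂ n u = 0 := by
  have : s₁ ≠ 0 := by rintro rfl; simp at hs₁
  simp [summand, max_eq_right hu, this]

theorem summand_of_pos (s₁ s₂ : ℂ) (n : ℕ) {u : ℝ} (hu : 0 < u) :
    summand s₁ s₂ n u = (u : ℂ) ^ (-s₁) * ((n + u : ℝ) : ℂ) ^ (-s₂) := by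
  simp [summand, max_eq_left hu.le]

theorem continuous_summand {s₁ : ℂ} (hs₁ : s₁.re < 0) (s₂ : ℂ) {n : ℕ} (hn : 0 < n) :
    Continuous (summand s₁ s₂ n) := by
  have h1 : Continuous fun u : ℝ => max u 0 := by fun_prop
  refine ((Complex.continuous_ofReal_cpow_const (by simpa using hs₁)).comp h1).mul ?_
  refine continuous_iff_continuousAt.2 fun u => ?_
  refine ContinuousAt.comp (f := fun u : ℝ => ((n + max u 0 : ℝ) : ℂ))
    (continuousAt_cpow_const ?_) (by fun_prop)
  left
  have : (0 : ℝ) < n := by exact_mod_cast hn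
  rw [Complex.ofReal_re]
  positivity

theorem summand_isBigO {s₁ s₂ : ℂ} (hs₁ : s₁.re < 0) (hs₂ : 0 ≤ s₂.re) (n : ℕ) :
    summand s₁ s₂ n =O[cocompact ℝ] fun u : ℝ => |u| ^ (-(s₁ + s₂).re) := by
  refine IsBigO.of_bound 1 (Eventually.of_forall fun u => ?_)
  rw [one_mul, Real.norm_of_nonneg (by positivity)]
  rcases le_or_gt u 0 with hu | hu
  · rw [summand_of_nonpos hs₁ _ _ hu, norm_zero]; positivity
  · rw [summand_of_pos _ _ _ hu, norm_mul, Complex.norm_cpow_eq_rpow_re_of_pos hu,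
      Complex.norm_cpow_eq_rpow_re_of_pos (by positivity), abs_of_pos hu, Complex.add_re, neg_add,
      Real.rpow_add hu]
    have hn : (0 : ℝ) ≤ n := n.cast_nonneg
    simp only [Complex.neg_re]
    exact mul_le_mul_of_nonneg_left
      (Real.rpow_le_rpow_of_nonpos hu (by linarith) (by linarith)) (by positivity)

open FourierTransform MeasureTheory Set in
theorem fourier_summand {s₁ : ℂ} (hs₁ : s₁.re < 0) (s₂ : ℂ) {n : ℕ} (hn : 0 < n) (k : ℝ) :
    𝓕 (summand s₁ s₂ n) k =
      (n : ℂ) ^ (1 - s₁ - s₂) * laplaceInt (1 - s₁) (-s₂) (2 * Real.pi * Complex.I * (n * k)) := by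
  have hn' : (0 : ℝ) < n := by exact_mod_cast hn
  have hn0 : (n : ℂ) ≠ 0 := by exact_mod_cast hn.ne'
  rw [Real.fourier_real_eq_integral_exp_smul]
  have h1 : ∀ v : ℝ, v ∉ Ioi (0 : ℝ) →
      Complex.exp (((-2 * Real.pi * v * k : ℝ) : ℂ) * Complex.I) • summand s₁ s₂ n v = 0 := by
    intro v hv
    rw [summand_of_nonpos hs₁ _ _ (by simpa using hv), smul_zero]
  rw [← setIntegral_eq_integral_of_forall_compl_eq_zero h1]
  have h2 := integral_comp_mul_left_Ioi (fun v : ℝ =>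
      Complex.exp (((-2 * Real.pi * v * k : ℝ) : ℂ) * Complex.I) • summand s₁ s₂ n v) 0 hn'
  rw [mul_zero] at h2
  have h3 : ∫ v in Ioi (0 : ℝ),
      Complex.exp (((-2 * Real.pi * v * k : ℝ) : ℂ) * Complex.I) • summand s₁ s₂ n v =
      (n : ℝ) • ∫ y in Ioi (0 : ℝ),
        Complex.exp (((-2 * Real.pi * (n * y) * k : ℝ) : ℂ) * Complex.I) •
          summand s₁ s₂ n (n * y) := by
    rw [h2, smul_smul, mul_inv_cancel₀ hn'.ne', one_smul]
  rw [h3, laplaceInt, ← integral_const_mul, ← integral_smul]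
  refine setIntegral_congr_fun measurableSet_Ioi fun y hy => ?_
  have hy : 0 < y := hy
  have e1 : ((n * y : ℝ) : ℂ) ^ (-s₁) = (n : ℂ) ^ (-s₁) * (y : ℂ) ^ (-s₁) := by
    rw [Complex.ofReal_mul, Complex.mul_cpow_ofReal_nonneg hn'.le hy.le, Complex.ofReal_natCast]
  have e2 : ((n + n * y : ℝ) : ℂ) ^ (-s₂) = (n : ℂ) ^ (-s₂) * (y + 1 : ℂ) ^ (-s₂) := by
    rw [show (n + n * y : ℝ) = n * (y + 1) by ring, Complex.ofReal_mul,
      Complex.mul_cpow_ofReal_nonneg hn'.le (by positivity), Complex.ofReal_natCast]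
    push_cast; rfl
  have e3 : (n : ℂ) ^ (1 - s₁ - s₂) = n * (n : ℂ) ^ (-s₁) * (n : ℂ) ^ (-s₂) := by
    rw [show 1 - s₁ - s₂ = 1 + -s₁ + -s₂ by ring, Complex.cpow_add _ _ hn0,
      Complex.cpow_add _ _ hn0, Complex.cpow_one]
  have e4 : (((-2 * Real.pi * (n * y) * k : ℝ) : ℂ) * Complex.I) =
      -(2 * Real.pi * Complex.I * (n * k)) * y := by push_cast; ring
  rw [summand_of_pos _ _ _ (mul_pos hn' hy), e1, e2, e3, e4, show 1 - s₁ - 1 = -s₁ by ring,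
    Complex.real_smul, smul_eq_mul, Complex.ofReal_natCast]
  ring

theorem laplaceInt_eq_remInt_invPoint {s₁ s₂ : ℂ} (hs₁ : s₁.re < 0) (hs : 1 < (s₁ + s₂).re)
    (e : ℤˣ) {l : ℕ} (hl : 0 < l) :
    laplaceInt (1 - s₁) (-s₂) (2 * Real.pi * Complex.I * (((e : ℤ) : ℂ) * l)) =
      remInt 0 (1 - s₁) (-s₂) (invPoint e l) := by
  have h0 : 2 * Real.pi * Complex.I * (((e : ℤ) : ℂ) * l) = (invPoint e l)⁻¹ := by
    rw [invPoint, inv_inv]; ring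
  have h1 := invPoint_ne_zero e hl
  simp only [Complex.add_re] at hs
  rw [h0, laplaceInt_eq_remInt (by simp; linarith) (by simp; linarith) (by simp; linarith) ?_
    (inv_ne_zero h1), inv_inv]
  rw [Complex.inv_re, invPoint_re, zero_div]

/-- The Fourier transform of `summand s₁ s₂ n` at `± k`, written in terms of `remInt`; see
`fourier_summand_eq_fourierTerm`. -/
def fourierTerm (e : ℤˣ) (s₁ s₂ : ℂ) (n k : ℕ+) : ℂ :=
  termR 0 e (fun _ => 1) (1 - s₂, 1 - s₁) (n, k)

theorem summable_fourierTerm {s₁ s₂ : ℂ} (hs₁ : s₁.re < 0) (hs : 1 < (s₁ + s₂).re) (e : ℤˣ)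
    (n : ℕ+) : Summable (fourierTerm e s₁ s₂ n) := by
  simp only [Complex.add_re] at hs
  -- The case of the constant coefficient sequence `1`.
  have h := summable_termR (κ := 1) isBigO_one_rpow 0 e (s := (1 - s₂, 1 - s₁))
    ⟨by simp; linarith, by simp; linarith⟩
  exact h.comp_injective (i := fun k : ℕ+ => (n, k)) fun k k' hk => (Prod.ext_iff.1 hk).2

open FourierTransform in
theorem fourier_summand_eq_fourierTerm {s₁ s₂ : ℂ} (hs₁ : s₁.re < 0) (hs : 1 < (s₁ + s₂).re)
    (e : ℤˣ) (n k : ℕ+) :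
    𝓕 (summand s₁ s₂ n) (((e : ℤ) : ℝ) * ((k : ℕ) : ℝ)) = fourierTerm e s₁ s₂ n k := by
  have h := laplaceInt_eq_remInt_invPoint hs₁ hs e (n * k).pos
  have h1 : 2 * Real.pi * Complex.I * (((n : ℕ) : ℂ) * ((((e : ℤ) : ℝ) * ((k : ℕ) : ℝ) : ℝ) : ℂ)) =
      2 * Real.pi * Complex.I * (((e : ℤ) : ℂ) * ((n * k : ℕ+) : ℕ)) := by
    rw [PNat.mul_coe]; push_cast; ring
  rw [fourier_summand hs₁ s₂ n.pos, fourierTerm, termR, h1, h]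
  simp only [mul_one]
  rw [show 1 - s₂ + (1 - s₁) - 1 = 1 - s₁ - s₂ by ring, show 1 - s₂ - 1 = -s₂ by ring]

/-- Poisson summation for the inner sum of the double series. -/
theorem tsum_summand_eq {s₁ s₂ : ℂ} (hs₁ : s₁.re < 0) (hs : 1 < (s₁ + s₂).re) (n : ℕ+) :
    ∑' m : ℕ+, ((m : ℕ) : ℂ) ^ (-s₁) * (((m : ℕ) : ℂ) + ((n : ℕ) : ℂ)) ^ (-s₂) =
      ((n : ℕ) : ℂ) ^ (1 - s₁ - s₂) *
        (Complex.Gamma (1 - s₁) * Complex.Gamma (s₁ + s₂ - 1) / Complex.Gamma s₂) +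
      ∑' k, fourierTerm 1 s₁ s₂ n k + ∑' k, fourierTerm (-1) s₁ s₂ n k := by
  have hs' := hs
  simp only [Complex.add_re] at hs
  have hF := hasSum_int_of_pnat
    (f := fun k : ℤ => FourierTransform.fourier (summand s₁ s₂ n) (k : ℝ))
    (x := ∑' k, fourierTerm 1 s₁ s₂ n k) (y := ∑' k, fourierTerm (-1) s₁ s₂ n k) ?_ ?_
  rotate_left
  · convert! (summable_fourierTerm hs₁ hs' 1 n).hasSum using 2 with k
    rw [← fourier_summand_eq_fourierTerm hs₁ hs']
    simp
  · convert! (summable_fourierTerm hs₁ hs' (-1) n).hasSum using 2 with k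
    rw [← fourier_summand_eq_fourierTerm hs₁ hs']
    simp
  have hP := Real.tsum_eq_tsum_fourier_of_rpow_decay_of_summable (continuous_summand hs₁ s₂ n.pos)
    hs' (summand_isBigO hs₁ (by linarith) n) hF.summable 0
  simp only [zero_add, QuotientAddGroup.mk_zero, fourier_eval_zero, mul_one] at hP
  rw [hF.tsum_eq] at hP
  have hS : Summable fun m : ℕ+ => summand s₁ s₂ n ((m : ℕ) : ℝ) := by
    have h1 := (summand_isBigO (s₂ := s₂) hs₁ (by linarith) n).comp_tendsto Int.tendsto_coe_cofinite
    have h2 := summable_of_isBigO (Real.summable_abs_int_rpow hs') h1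
    have h3 := h2.comp_injective (i := fun m : ℕ+ => ((m : ℕ) : ℤ))
      (Nat.cast_injective.comp PNat.coe_injective)
    simpa [Function.comp_def] using h3
  have hL := hasSum_int_of_pnat (f := fun m : ℤ => summand s₁ s₂ n (m : ℝ)) (y := 0)
    (by simpa using hS.hasSum) (by
      convert! hasSum_zero using 2 with m
      rw [summand_of_nonpos hs₁]
      simp)
  rw [hL.tsum_eq] at hP
  have h0 : summand s₁ s₂ n ((0 : ℤ) : ℝ) = 0 := summand_of_nonpos hs₁ _ _ (by simp)
  rw [h0, zero_add, add_zero] at hP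
  have hG : FourierTransform.fourier (summand s₁ s₂ n) ((0 : ℤ) : ℝ) =
      ((n : ℕ) : ℂ) ^ (1 - s₁ - s₂) *
        (Complex.Gamma (1 - s₁) * Complex.Gamma (s₁ + s₂ - 1) / Complex.Gamma s₂) := by
    rw [fourier_summand hs₁ s₂ n.pos]
    simp only [Int.cast_zero, Complex.ofReal_zero, mul_zero]
    rw [laplaceInt_zero (by simp; linarith) (by simp; linarith), neg_neg,
      show -(1 - s₁) - -s₂ = s₁ + s₂ - 1 by ring]
  rw [← hG, ← hP]
  refine tsum_congr fun m => ?_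
  rw [summand_of_pos _ _ _ (by exact_mod_cast m.pos)]
  push_cast
  rw [add_comm ((m : ℕ) : ℂ)]

/-! ### The double series -/

/-- The region where the double series converges absolutely. -/
def regionL₂ (κ : ℝ) : Set (ℂ × ℂ) :=
  {s | (κ + 1) / 2 < s.2.re ∧ (κ + 3) / 2 < (s.1 + s.2).re}

theorem isOpen_regionL₂ (κ : ℝ) : IsOpen (regionL₂ κ) :=
  IsOpen.inter (s := {s : ℂ × ℂ | (κ + 1) / 2 < s.2.re})
    (t := {s : ℂ × ℂ | (κ + 3) / 2 < (s.1 + s.2).re})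
    (isOpen_lt (by fun_prop) (by fun_prop)) (isOpen_lt (by fun_prop) (by fun_prop))

theorem isPreconnected_regionL₂ (κ : ℝ) : IsPreconnected (regionL₂ κ) := by
  refine Convex.isPreconnected ?_
  intro x hx y hy p q hp hq hpq
  obtain ⟨hx1, hx2⟩ := hx
  obtain ⟨hy1, hy2⟩ := hy
  simp only [Complex.add_re] at hx2 hy2
  have hq' : q = 1 - p := by linarith
  subst hq'
  rcases hp.eq_or_lt with rfl | hp
  · simpa [regionL₂] using And.intro hy1 hy2
  constructor <;> simp <;> nlinarith

theorem norm_termL₂ (a : ℕ → ℂ) (s₁ s₂ : ℂ) (m n : ℕ+) : ‖termL₂ a s₁ s₂ (m, n)‖ =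
    ‖a n‖ * ((((m : ℕ) : ℝ) ^ (-s₁.re)) * (((m : ℕ) : ℝ) + ((n : ℕ) : ℝ)) ^ (-s₂.re)) := by
  have hm : (0 : ℝ) < ((m : ℕ) : ℝ) := by exact_mod_cast m.pos
  have hn : (0 : ℝ) < ((n : ℕ) : ℝ) := by exact_mod_cast n.pos
  rw [termL₂, norm_div, norm_mul,
    show ((m : ℕ) : ℂ) + ((n : ℕ) : ℂ) = ((((m : ℕ) : ℝ) + ((n : ℕ) : ℝ) : ℝ) : ℂ) by
      push_cast; rfl,
    Complex.norm_cpow_eq_rpow_re_of_pos (by positivity),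
    Complex.norm_natCast_cpow_of_pos m.pos, Real.rpow_neg hm.le, Real.rpow_neg (by positivity),
    div_eq_mul_inv, mul_inv]

/-- Near each point of `regionL₂ κ` the double series is dominated by a convergent one: part of
`(m+n)^{-σ₂}` goes into `n^{-β}` with `β` slightly above `(κ+1)/2` and the rest into a power
of `m`. -/
theorem exists_termL₂_bound
    (ha : ∀ ε : ℝ, 0 < ε → a =O[atTop] fun n : ℕ => (n : ℝ) ^ ((κ - 1) / 2 + ε))
    (hκ : 1 ≤ κ) {s : ℂ × ℂ} (hs : s ∈ regionL₂ κ) :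
    ∃ U : Set (ℂ × ℂ), IsOpen U ∧ s ∈ U ∧ ∃ u : ℕ+ × ℕ+ → ℝ, Summable u ∧
      ∀ p, ∀ z ∈ U, ‖termL₂ a z.1 z.2 p‖ ≤ u p := by
  obtain ⟨h1, h2⟩ := hs
  simp only [Complex.add_re] at h2
  let δ := min (s.2.re - (κ + 1) / 2) (s.1.re + s.2.re - (κ + 3) / 2) / 4
  have hδ : 0 < δ := div_pos (lt_min (by linarith) (by linarith)) (by norm_num)
  have hδ1 : 4 * δ ≤ s.2.re - (κ + 1) / 2 := by
    have := min_le_left (s.2.re - (κ + 1) / 2) (s.1.re + s.2.re - (κ + 3) / 2)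
    simp only [δ]; linarith
  have hδ2 : 4 * δ ≤ s.1.re + s.2.re - (κ + 3) / 2 := by
    have := min_le_right (s.2.re - (κ + 1) / 2) (s.1.re + s.2.re - (κ + 3) / 2)
    simp only [δ]; linarith
  let β := (κ + 1) / 2 + δ
  let γ := s.2.re - δ - β
  have hγ : 0 ≤ γ := by simp only [γ, β]; linarith
  refine ⟨{z | s.1.re - δ < z.1.re} ∩ {z | s.2.re - δ < z.2.re},
    IsOpen.inter (isOpen_lt (by fun_prop) (by fun_prop)) (isOpen_lt (by fun_prop) (by fun_prop)),
    ⟨by simpa using hδ, by simpa using hδ⟩,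
    fun p => ((p.1 : ℕ) : ℝ) ^ (-(s.1.re - δ + γ)) * (‖a p.2‖ * ((p.2 : ℕ) : ℝ) ^ (-β)), ?_, ?_⟩
  · refine Summable.mul_of_nonneg (f := fun m : ℕ+ => ((m : ℕ) : ℝ) ^ (-(s.1.re - δ + γ)))
      (g := fun n : ℕ+ => ‖a n‖ * ((n : ℕ) : ℝ) ^ (-β))
      (summable_pnat_rpow_neg (by simp only [γ, β]; linarith))
      (summable_norm_coeff ha (by simp only [β]; linarith))
      (fun n => by positivity) (fun n => by positivity)
  · rintro ⟨m, n⟩ z ⟨hz1, hz2⟩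
    have hz1 : s.1.re - δ < z.1.re := hz1
    have hz2 : s.2.re - δ < z.2.re := hz2
    have hm : (0 : ℝ) < ((m : ℕ) : ℝ) := by exact_mod_cast m.pos
    have hn : (0 : ℝ) < ((n : ℕ) : ℝ) := by exact_mod_cast n.pos
    have hm1 : (1 : ℝ) ≤ ((m : ℕ) : ℝ) := by exact_mod_cast m.pos
    have hn1 : (1 : ℝ) ≤ ((n : ℕ) : ℝ) := by exact_mod_cast n.pos
    have h3 : (((m : ℕ) : ℝ) + ((n : ℕ) : ℝ)) ^ (-z.2.re) ≤
        ((m : ℕ) : ℝ) ^ (-γ) * ((n : ℕ) : ℝ) ^ (-β) := by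
      calc _ ≤ (((m : ℕ) : ℝ) + ((n : ℕ) : ℝ)) ^ (-γ + -β) :=
            Real.rpow_le_rpow_of_exponent_le (by linarith) (by simp only [γ]; linarith)
        _ = (((m : ℕ) : ℝ) + ((n : ℕ) : ℝ)) ^ (-γ) * (((m : ℕ) : ℝ) + ((n : ℕ) : ℝ)) ^ (-β) :=
            Real.rpow_add (by linarith) _ _
        _ ≤ _ := by
            refine mul_le_mul (Real.rpow_le_rpow_of_nonpos hm (by linarith) (by linarith)) ?_
              (by positivity) (by positivity)
            exact Real.rpow_le_rpow_of_nonpos hn (by linarith) (by simp only [β]; linarith)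
    rw [norm_termL₂]
    calc _ ≤ ‖a n‖ * (((m : ℕ) : ℝ) ^ (-(s.1.re - δ)) *
          (((m : ℕ) : ℝ) ^ (-γ) * ((n : ℕ) : ℝ) ^ (-β))) := by gcongr
      _ = _ := by
          beta_reduce
          rw [neg_add (s.1.re - δ), Real.rpow_add hm]; ring

theorem summable_termL₂
    (ha : ∀ ε : ℝ, 0 < ε → a =O[atTop] fun n : ℕ => (n : ℝ) ^ ((κ - 1) / 2 + ε))
    (hκ : 1 ≤ κ) {s : ℂ × ℂ} (hs : s ∈ regionL₂ κ) : Summable (termL₂ a s.1 s.2) := by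
  obtain ⟨U, -, hsU, u, hu, hb⟩ := exists_termL₂_bound ha hκ hs
  exact Summable.of_norm_bounded hu fun p => hb p s hsU

theorem analyticAt_tsum_termL₂
    (ha : ∀ ε : ℝ, 0 < ε → a =O[atTop] fun n : ℕ => (n : ℝ) ^ ((κ - 1) / 2 + ε))
    (hκ : 1 ≤ κ) {s : ℂ × ℂ} (hs : s ∈ regionL₂ κ) :
    AnalyticAt ℂ (fun z : ℂ × ℂ => ∑' p, termL₂ a z.1 z.2 p) s := by
  obtain ⟨U, hU, hsU, u, hu, hb⟩ := exists_termL₂_bound ha hκ hs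
  refine analyticOnNhd_tsum hU hu (fun p z hz => ?_) hb s hsU
  have h1 : ((p.1 : ℕ) : ℂ) ≠ 0 := by exact_mod_cast p.1.ne_zero
  have h2 : ((p.1 : ℕ) : ℂ) + ((p.2 : ℕ) : ℂ) ≠ 0 := by
    have := p.1.pos
    exact_mod_cast (by omega : (p.1 : ℕ) + p.2 ≠ 0)
  have h1' : ((p.1 : ℕ) : ℂ) ∈ Complex.slitPlane := Or.inl (by simp)
  have h2' : ((p.1 : ℕ) : ℂ) + ((p.2 : ℕ) : ℂ) ∈ Complex.slitPlane := Or.inl (by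
    have := p.1.pos
    simp only [Complex.add_re, Complex.natCast_re]; positivity)
  refine analyticAt_const.div ((AnalyticAt.cpow analyticAt_const analyticAt_fst h1').mul
    (AnalyticAt.cpow analyticAt_const analyticAt_snd h2')) ?_
  exact mul_ne_zero (by simp [Complex.cpow_eq_zero_iff, h1])
    (by simp [Complex.cpow_eq_zero_iff, h2])

/-- The function `L₁`, with junk values at its singularities. -/
def rawL₁ (L : ℂ → ℂ) (s : ℂ × ℂ) : ℂ :=
  Complex.Gamma (1 - s.1) * Complex.Gamma (s.1 + s.2 - 1) / Complex.Gamma s.2 * L (s.1 + s.2 - 1)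

/-- The involution `(s₁,s₂) ↦ (1-s₂,1-s₁)`. -/
def reflect (s : ℂ × ℂ) : ℂ × ℂ := (1 - s.2, 1 - s.1)

theorem analyticAt_reflect (s : ℂ × ℂ) : AnalyticAt ℂ reflect s :=
  (analyticAt_const.sub analyticAt_snd).prod (analyticAt_const.sub analyticAt_fst)

theorem isOpenMap_reflect : IsOpenMap reflect :=
  (((Homeomorph.subLeft (1 : ℂ)).prodCongr (Homeomorph.subLeft (1 : ℂ))).isOpenMap.comp
    (Homeomorph.prodComm ℂ ℂ).isOpenMap)

/-- The right-hand side of the functional equation; it defines the continuation of `L₂`. -/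
def rawL₂ (κ : ℝ) (a : ℕ → ℂ) (L : ℂ → ℂ) (s : ℂ × ℂ) : ℂ :=
  rawL₁ L s + Complex.Gamma (1 - s.1) *
    (rawF κ 1 a L (reflect s) + rawF κ (-1) a L (reflect s))

theorem analyticAt_Gamma {z : ℂ} (hz : ∀ k : ℕ, z ≠ -(k : ℂ)) : AnalyticAt ℂ Complex.Gamma z := by
  have h := (Complex.differentiable_one_div_Gamma.analyticAt z).inv
    (inv_ne_zero (Complex.Gamma_ne_zero hz))
  exact h.congr (Eventually.of_forall fun w => by simp)

theorem isOpenMap_fst_add_snd_sub (c : ℂ) : IsOpenMap fun s : ℂ × ℂ => s.1 + s.2 - c := by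
  have h : IsOpenMap fun s : ℂ × ℂ => s.1 + s.2 := by
    refine (ContinuousLinearMap.fst ℂ ℂ ℂ + ContinuousLinearMap.snd ℂ ℂ ℂ).isOpenMap fun z => ?_
    exact ⟨(z, 0), by simp⟩
  exact (Homeomorph.subRight c).isOpenMap.comp h

theorem isOpenMap_const_sub_fst (b : ℂ) : IsOpenMap fun s : ℂ × ℂ => b - s.1 :=
  (Homeomorph.subLeft b).isOpenMap.comp isOpenMap_fst

theorem meromorphicAtTwo_Gamma_one_sub (s : ℂ × ℂ) :
    MeromorphicAtTwo (fun s : ℂ × ℂ => Complex.Gamma (1 - s.1)) s :=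
  (Meromorphic.Gamma _).meromorphicAtTwo_comp (analyticAt_const.sub analyticAt_fst)
    (isOpenMap_const_sub_fst 1)

theorem meromorphicAtTwo_rawL₁ {L : ℂ → ℂ} (hL : Meromorphic L) (s : ℂ × ℂ) :
    MeromorphicAtTwo (rawL₁ L) s := by
  have h : AnalyticAt ℂ (fun s : ℂ × ℂ => s.1 + s.2 - 1) s :=
    (analyticAt_fst.add analyticAt_snd).sub analyticAt_const
  exact (((meromorphicAtTwo_Gamma_one_sub s).mul
    ((Meromorphic.Gamma _).meromorphicAtTwo_comp h (isOpenMap_fst_add_snd_sub 1))).mul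
    (analyticAt_inv_Gamma_snd s).meromorphicAtTwo).mul
    ((hL _).meromorphicAtTwo_comp h (isOpenMap_fst_add_snd_sub 1))

theorem analyticAt_rawL₁ {L : ℂ → ℂ} {s : ℂ × ℂ} (h1 : ∀ k : ℕ, 1 - s.1 ≠ -(k : ℂ))
    (h2 : ∀ k : ℕ, s.1 + s.2 - 1 ≠ -(k : ℂ)) (hL : AnalyticAt ℂ L (s.1 + s.2 - 1)) :
    AnalyticAt ℂ (rawL₁ L) s := by
  have h : AnalyticAt ℂ (fun s : ℂ × ℂ => s.1 + s.2 - 1) s :=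
    (analyticAt_fst.add analyticAt_snd).sub analyticAt_const
  have h' : AnalyticAt ℂ (fun s : ℂ × ℂ => 1 - s.1) s := analyticAt_const.sub analyticAt_fst
  have g1 := AnalyticAt.fun_comp (f := fun s : ℂ × ℂ => 1 - s.1) (x := s) (analyticAt_Gamma h1) h'
  have g2 := AnalyticAt.fun_comp (f := fun s : ℂ × ℂ => s.1 + s.2 - 1) (x := s)
    (analyticAt_Gamma h2) h
  have g3 := AnalyticAt.fun_comp (f := fun s : ℂ × ℂ => s.1 + s.2 - 1) (x := s) hL h
  exact ((g1.mul g2).mul (analyticAt_inv_Gamma_snd s)).mul g3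

theorem meromorphicAtTwo_rawL₂ {L : ℂ → ℂ}
    (ha : ∀ ε : ℝ, 0 < ε → a =O[atTop] fun n : ℕ => (n : ℝ) ^ ((κ - 1) / 2 + ε))
    (hLm : Meromorphic L) (hL : ∀ s : ℂ, (κ + 1) / 2 < s.re → L s = LSeries a s)
    (s : ℂ × ℂ) : MeromorphicAtTwo (rawL₂ κ a L) s :=
  (meromorphicAtTwo_rawL₁ hLm s).add ((meromorphicAtTwo_Gamma_one_sub s).mul
    (((meromorphicAtTwo_rawF ha hLm hL 1 _).comp (analyticAt_reflect s) isOpenMap_reflect).add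
      ((meromorphicAtTwo_rawF ha hLm hL (-1) _).comp (analyticAt_reflect s) isOpenMap_reflect)))

/-- The functional equation where all the series converge, by Poisson summation over `m`. -/
theorem tsum_termL₂_eq_rawL₂ {L : ℂ → ℂ}
    (ha : ∀ ε : ℝ, 0 < ε → a =O[atTop] fun n : ℕ => (n : ℝ) ^ ((κ - 1) / 2 + ε))
    (hκ : 1 ≤ κ) (hL : ∀ s : ℂ, (κ + 1) / 2 < s.re → L s = LSeries a s)
    {s : ℂ × ℂ} (hs : s ∈ regionL₂ κ) (hs₁ : s.1.re < 0) :
    ∑' p, termL₂ a s.1 s.2 p = rawL₂ κ a L s := by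
  have hR : reflect s ∈ regionR κ 0 := by
    have := hs.1
    exact ⟨by simp [reflect]; linarith, by simp [reflect]; linarith⟩
  have h1s : 1 < (s.1 + s.2).re := by have := hs.2; linarith
  have hΓ : Complex.Gamma (1 - s.1) ≠ 0 := Complex.Gamma_ne_zero_of_re_pos (by simp; linarith)
  have hcoeff := hasSum_coeff (s := s.1 + s.2 - 1) ha hL (by
    have := hs.2
    simp only [Complex.sub_re, Complex.one_re]; linarith)
  have hterm : ∀ (e : ℤˣ) (n k : ℕ+), termR 0 e a (reflect s) (n, k) =
      a n * fourierTerm e s.1 s.2 n k := by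
    intro e n k
    simp only [fourierTerm, termR, reflect]
    ring
  have hS : ∀ e : ℤˣ, HasSum (fun n : ℕ+ => a n * ∑' k, fourierTerm e s.1 s.2 n k)
      (∑' p, termR 0 e a (reflect s) p) := by
    intro e
    have h := summable_termR ha 0 e hR
    refine h.hasSum.prod_fiberwise fun n => ?_
    simp only [hterm]
    exact (summable_fourierTerm hs₁ h1s e n).hasSum.mul_left _
  have hraw : ∀ e : ℤˣ, ∑' p, termR 0 e a (reflect s) p =
      Complex.Gamma (1 - s.1) * rawF κ e a L (reflect s) := by
    intro e
    rw [rawF_eq_tsum ha hL e hR, ← mul_assoc]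
    simp only [reflect]
    rw [mul_inv_cancel₀ hΓ, one_mul]
  have hsw : Summable fun p : ℕ+ × ℕ+ => termL₂ a s.1 s.2 (p.2, p.1) :=
    (Equiv.prodComm ℕ+ ℕ+).summable_iff.2 (summable_termL₂ ha hκ hs)
  have hsum : ∑' p, termL₂ a s.1 s.2 p = ∑' n : ℕ+, ∑' m : ℕ+, termL₂ a s.1 s.2 (m, n) := by
    rw [← (Equiv.prodComm ℕ+ ℕ+).tsum_eq (termL₂ a s.1 s.2)]
    exact hsw.tsum_prod
  have hin : ∀ n : ℕ+, ∑' m : ℕ+, termL₂ a s.1 s.2 (m, n) =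
      (a n * ((n : ℕ) : ℂ) ^ (-(s.1 + s.2 - 1))) *
        (Complex.Gamma (1 - s.1) * Complex.Gamma (s.1 + s.2 - 1) / Complex.Gamma s.2) +
      a n * ∑' k, fourierTerm 1 s.1 s.2 n k + a n * ∑' k, fourierTerm (-1) s.1 s.2 n k := by
    intro n
    have h := tsum_summand_eq hs₁ h1s n
    have h2 : ∀ m : ℕ+, termL₂ a s.1 s.2 (m, n) = a n *
        (((m : ℕ) : ℂ) ^ (-s.1) * (((m : ℕ) : ℂ) + ((n : ℕ) : ℂ)) ^ (-s.2)) := by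
      intro m
      rw [termL₂, Complex.cpow_neg, Complex.cpow_neg, div_eq_mul_inv, mul_inv]
    rw [tsum_congr h2, tsum_mul_left, h, show -(s.1 + s.2 - 1) = 1 - s.1 - s.2 by ring]
    ring
  rw [hsum, tsum_congr hin, (((hcoeff.mul_right _).add (hS 1)).add (hS (-1))).tsum_eq, hraw, hraw,
    rawL₂, rawL₁]
  ring

theorem generic_rawL₂_eq {L : ℂ → ℂ}
    (ha : ∀ ε : ℝ, 0 < ε → a =O[atTop] fun n : ℕ => (n : ℝ) ^ ((κ - 1) / 2 + ε))
    (hκ : 1 ≤ κ) (hLm : Meromorphic L) (hL : ∀ s : ℂ, (κ + 1) / 2 < s.re → L s = LSeries a s)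
    {s : ℂ × ℂ} (hs : s ∈ regionL₂ κ) :
    rawL₂ κ a L =ᶠ[genericAt s] fun z => ∑' p, termL₂ a z.1 z.2 p := by
  -- A point of the region with `Re s₁ < 0`, near which the functional equation is known.
  let p₀ : ℂ × ℂ := (-1, ((κ + 3 : ℝ) : ℂ))
  have hp₀ : p₀ ∈ regionL₂ κ := ⟨by
    simp only [p₀, Complex.ofReal_re]; linarith, by
    simp only [p₀, Complex.add_re, Complex.ofReal_re, Complex.neg_re, Complex.one_re]; linarith⟩
  refine genericAt_eq_of_isPreconnected (isPreconnected_regionL₂ κ)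
    (fun p _ => meromorphicAtTwo_rawL₂ ha hLm hL p)
    (fun p hp => (analyticAt_tsum_termL₂ ha hκ hp).meromorphicAtTwo) hp₀
    (genericAt_le_nhds p₀ ?_) s hs
  have hn : IsOpen {z : ℂ × ℂ | z.1.re < 0} := isOpen_lt (by fun_prop) (by fun_prop)
  filter_upwards [(isOpen_regionL₂ κ).mem_nhds hp₀,
    hn.mem_nhds (by simp [p₀] : p₀ ∈ _)] with z h1 h2
  exact (tsum_termL₂_eq_rawL₂ ha hκ hL h1 h2).symm

theorem normalForm_reflect_eq {F : ℂ × ℂ → ℂ} (hF : ∀ p, MeromorphicAtTwo F p) (s : ℂ × ℂ) :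
    (fun z => normalForm F (reflect z)) =ᶠ[genericAt s] fun z => F (reflect z) :=
  (tendsto_genericAt (analyticAt_reflect s) isOpenMap_reflect).eventually
    (hF (reflect s)).normalForm_eq

theorem isContinuationF_normalForm {L : ℂ → ℂ}
    (ha : ∀ ε : ℝ, 0 < ε → a =O[atTop] fun n : ℕ => (n : ℝ) ^ ((κ - 1) / 2 + ε))
    (hLm : Meromorphic L) (hL : ∀ s : ℂ, (κ + 1) / 2 < s.re → L s = LSeries a s) (e : ℤˣ) :
    IsContinuationF e κ a (normalForm (rawF κ e a L)) := by
  refine ⟨isMeromorphicTwo_normalForm (meromorphicAtTwo_rawF ha hLm hL e), fun s₁ s₂ h1 h2 => ?_⟩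
  have hs : (s₁, s₂) ∈ regionR κ 0 := ⟨by simpa using h1, by simpa using h2⟩
  rw [normalForm_eq_of_analyticAt (analyticAt_rawF ha hL e hs)]
  exact hasSum_termF ha hL e hs

theorem isL₁_normalForm {L : ℂ → ℂ} (hLm : Meromorphic L) : IsL₁ L (normalForm (rawL₁ L)) :=
  ⟨isMeromorphicTwo_normalForm (meromorphicAtTwo_rawL₁ hLm), fun _ _ h1 h2 h3 =>
    normalForm_eq_of_analyticAt (analyticAt_rawL₁ h1 h2 h3)⟩

theorem isContinuationL₂_normalForm {L : ℂ → ℂ}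
    (ha : ∀ ε : ℝ, 0 < ε → a =O[atTop] fun n : ℕ => (n : ℝ) ^ ((κ - 1) / 2 + ε))
    (hκ : 1 ≤ κ) (hLm : Meromorphic L) (hL : ∀ s : ℂ, (κ + 1) / 2 < s.re → L s = LSeries a s) :
    IsContinuationL₂ κ a (normalForm (rawL₂ κ a L)) := by
  refine ⟨isMeromorphicTwo_normalForm (meromorphicAtTwo_rawL₂ ha hLm hL), fun s₁ s₂ h1 h2 => ?_⟩
  have hs : (s₁, s₂) ∈ regionL₂ κ := ⟨h1, h2⟩
  rw [normalForm_eq_of_generic (analyticAt_tsum_termL₂ ha hκ hs)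
    (generic_rawL₂_eq ha hκ hLm hL hs)]
  exact (summable_termL₂ ha hκ hs).hasSum

end

theorem theorem1 (a : ℕ → ℂ) (κ : ℝ) (hκ : 1 ≤ κ)
    (ha : ∀ ε : ℝ, 0 < ε → a =O[atTop] fun n : ℕ => (n : ℝ) ^ ((κ - 1) / 2 + ε))
    (L : ℂ → ℂ) (hL : Meromorphic L) (hLpoles : {z : ℂ | meromorphicOrderAt L z < 0}.Finite)
    (hLseries : ∀ s : ℂ, (κ + 1) / 2 < s.re → L s = LSeries a s) :
    ∃ Fp Fm L₁ L₂ : ℂ × ℂ → ℂ,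
      IsContinuationF 1 κ a Fp ∧ IsContinuationF (-1) κ a Fm ∧
      IsL₁ L L₁ ∧ IsContinuationL₂ κ a L₂ ∧
      ∀ s₁ s₂ : ℂ, (∀ k : ℕ, 1 - s₁ ≠ -(k : ℂ)) →
        AnalyticAt ℂ L₂ (s₁, s₂) → AnalyticAt ℂ L₁ (s₁, s₂) →
        AnalyticAt ℂ Fp (1 - s₂, 1 - s₁) → AnalyticAt ℂ Fm (1 - s₂, 1 - s₁) →
        L₂ (s₁, s₂) = L₁ (s₁, s₂)
          + Complex.Gamma (1 - s₁) * (Fp (1 - s₂, 1 - s₁) + Fm (1 - s₂, 1 - s₁)) := by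
  refine ⟨_, _, _, _, isContinuationF_normalForm ha hL hLseries 1,
    isContinuationF_normalForm ha hL hLseries (-1), isL₁_normalForm hL,
    isContinuationL₂_normalForm ha hκ hL hLseries, ?_⟩
  intro s₁ s₂ hΓ hL₂ hL₁ hFp hFm
  have hG : AnalyticAt ℂ (fun s : ℂ × ℂ => Complex.Gamma (1 - s.1)) (s₁, s₂) :=
    AnalyticAt.fun_comp (f := fun s : ℂ × ℂ => 1 - s.1) (x := (s₁, s₂))
      (analyticAt_Gamma hΓ) (analyticAt_const.sub analyticAt_fst)
  have hr := analyticAt_reflect (s₁, s₂)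
  have hrhs : AnalyticAt ℂ (fun s : ℂ × ℂ => normalForm (rawL₁ L) s + Complex.Gamma (1 - s.1) *
      (normalForm (rawF κ 1 a L) (reflect s) + normalForm (rawF κ (-1) a L) (reflect s)))
      (s₁, s₂) :=
    hL₁.add (hG.mul ((AnalyticAt.fun_comp (x := (s₁, s₂)) (f := reflect) hFp hr).add
      (AnalyticAt.fun_comp (x := (s₁, s₂)) (f := reflect) hFm hr)))
  -- Both sides are analytic at the point, so it is enough that they agree generically near it.
  refine eq_of_genericAt hL₂ hrhs ?_
  filter_upwards [(meromorphicAtTwo_rawL₂ ha hL hLseries (s₁, s₂)).normalForm_eq,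
    (meromorphicAtTwo_rawL₁ hL (s₁, s₂)).normalForm_eq,
    normalForm_reflect_eq (meromorphicAtTwo_rawF ha hL hLseries 1) (s₁, s₂),
    normalForm_reflect_eq (meromorphicAtTwo_rawF ha hL hLseries (-1)) (s₁, s₂)] with z h1 h2 h3 h4
  rw [h1, h2, h3, h4, rawL₂]
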